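/- Setting. In the Submodular Matroid Secretary Problem (SMSP) there are a matroid $\mathcal M=(E,\mathcal I)$ on a finite ground set and a non-negative submodular function $f\colon 2^E\to\mathbb R_{\ge 0}$. The elements of $E$ arrive in a uniformly random order. An online algorithm knows $n=|E|$ in advance and must irrevocably accept or reject each element upon its arrival; it may use internal randomness and may query, for any set $S$ of elements that have already arrived, the value $f(S)$ and whether $S\in\mathcal I$ (elements may also carry observable names, revealed on arrival, about which nothing is assumed). The set of accepted elements, its output, must always be independent. The Matroid Secretary Problem (MSP) is the special case $f(S)=w(S):=\sum_{u\in S}w(u)$ with weights $w\colon E\to\mathbb R_{\ge 0}$. An algorithm has competitive ratio at most $c$ on $\mathcal M$ (is $c$-competitive for $\mathcal M$) if, for every objective function allowed in the problem, the expected value of its output is at least $1/c$ times the maximum value of an independent set. Theorem. Let $\mathsf{Linear}$ be an algorithm for MSP and let $\alpha\ge 1$. There is an algorithm for SMSP, depending only on $\mathsf{Linear}$ and $\alpha$, such that for every matroid $\mathcal M$ and every integer $k\ge 1$ the following holds. Suppose that for every MSP instance over $\mathcal M$, with weight function $w$, there are $k$ (possibly correlated) random sets $P_1,\dots,P_k\subseteq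 E$ such that each $P_i$ is always independent in $\mathcal M$, $$\mathbb E\Big[w\Big(\bigcup_{i=1}^k P_i\Big)\Big]\ \ge\ \frac1\alpha\,\max_{I\in\mathcal I}w(I),$$ and the output of $\mathsf{Linear}$ on this instance is distributed as a uniformly random one of the sets $P_1,\dots,P_k$. Then the competitive ratio of the SMSP algorithm on $\mathcal M$ is at most $24k\alpha(3\alpha+1)$. Moreover, $\mathsf{Linear}$ is then $(k\alpha)$-competitive for $\mathcal M$ on MSP. -/

import Mathlib

universe l u v w

namespace MatroidSecretary

/-- A ground set `ι` whose elements carry observable names from `Λ`, together with a value oracle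
and an independence oracle for the subsets of `ι`.  For a one-point type `Λ` the names carry no
information, and an algorithm has access to the two oracles only. -/
structure OracleData (Λ : Type l) (ι : Type u) where
  /-- the observable name of an element -/
  label : ι → Λ
  /-- the value oracle -/
  value : Finset ι → ℝ
  /-- the independence oracle -/
  indep : Finset ι → Prop

namespace OracleData

variable {Λ : Type l} {ι : Type u} {κ : Type w}

/-- The part of the oracles that concerns only the elements in the range of `e`. -/
def restrict (O : OracleData Λ ι) (e : κ ↪ ι) : OracleData Λ κ where
  label i := O.label (e i)
  value S := O.value (S.map e)
  indep S := O.indep (S.map e)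

/-- The value of an optimal offline solution: the maximum value of an independent set. -/
noncomputable def opt (O : OracleData Λ ι) : ℝ := sSup (O.value '' {S | O.indep S})

end OracleData

/-- An arrival order of the elements of `E`: `σ t` is the element arriving at time `t`. -/
abbrev ArrivalOrder (E : Type u) [Fintype E] : Type u := Fin (Fintype.card E) ≃ E

/-- The first `t + 1` arriving elements, in their order of arrival. -/
def ArrivalOrder.arrived {E : Type u} [Fintype E] (σ : ArrivalOrder E)
    (t : Fin (Fintype.card E)) : Fin ((t : ℕ) + 1) ↪ E :=
  (Fin.castLEEmb (Nat.succ_le_of_lt t.isLt)).trans σ.toEmbedding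

/-- A randomized online algorithm for secretary problems, that is, a probability distribution over
deterministic online algorithms.  It knows the number `n` of elements in advance.  When the element
at position `t` (counted from `0`) arrives, it must irrevocably accept or reject this element, and
the decision depends only on `n`, on the random seed, and on what the oracles say about the elements
that have arrived so far; these are numbered `0, …, t` by their order of arrival.
(Earlier decisions are functions of the same data, and need not be passed on separately.) -/
structure OnlineAlgorithm (Λ : Type l) where
  /-- the space of random seeds -/
  Seed : ℕ → Type v
  /-- the measurable sets of seeds -/
  seedSpace : ∀ n, MeasurableSpace (Seed n)
  /-- the distribution of the seed -/
  law : ∀ n, MeasureTheory.Measure (Seed n)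
  isProbabilityMeasure_law : ∀ n, MeasureTheory.IsProbabilityMeasure (law n)
  /-- whether the element arriving at time `t` is accepted -/
  accept : ∀ n : ℕ, Seed n → ∀ t : ℕ, OracleData Λ (Fin (t + 1)) → Bool
  measurable_accept : ∀ (n t : ℕ) (V : OracleData Λ (Fin (t + 1))),
    Measurable (fun ω : Seed n => accept n ω t V)

/-- The instance with matroid `M`, names `lab` and objective function `f`. -/
def smspInstance {Λ : Type l} {E : Type u} (M : Matroid E) (lab : E → Λ) (f : Finset E → ℝ) :
    OracleData Λ E where
  label := lab
  value := f
  indep S := M.Indep (S : Set E)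

/-- The instance with matroid `M`, names `lab` and the linear objective function given by the
weights `c`. -/
def mspInstance {Λ : Type l} {E : Type u} (M : Matroid E) (lab : E → Λ) (c : E → ℝ) :
    OracleData Λ E :=
  smspInstance M lab (fun S => ∑ e ∈ S, c e)

open Classical in
/-- A non-negative submodular function (diminishing returns). -/
def IsNonnegSubmodular {E : Type u} (f : Finset E → ℝ) : Prop :=
  (∀ S, 0 ≤ f S) ∧
    ∀ S T : Finset E, S ⊆ T → ∀ e, e ∉ T → f (insert e T) - f T ≤ f (insert e S) - f S

namespace OnlineAlgorithm

variable {Λ : Type l} (A : OnlineAlgorithm.{l, v} Λ) {E : Type u} [Fintype E]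

/-- The set of accepted elements, for a fixed arrival order and a fixed seed. -/
def run (O : OracleData Λ E) (σ : ArrivalOrder E) (ω : A.Seed (Fintype.card E)) : Finset E :=
  (Finset.univ.filter fun t : Fin (Fintype.card E) =>
    A.accept (Fintype.card E) ω t (O.restrict (σ.arrived t)) = true).map σ.toEmbedding

open Classical in
/-- The probability that the set of accepted elements is `S`, for a uniformly random arrival order
and an independent random seed. -/
noncomputable def outputProb (O : OracleData Λ E) (S : Finset E) : ℝ :=
  (∑ σ : ArrivalOrder E, (A.law (Fintype.card E) {ω | A.run O σ ω = S}).toReal) /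
    (Fintype.card (ArrivalOrder E) : ℝ)

/-- The expected value of the set of accepted elements. -/
noncomputable def expectedValue (O : OracleData Λ E) : ℝ :=
  ∑ S : Finset E, A.outputProb O S * O.value S

/-- `A` is an algorithm for the matroid secretary problem: it accepts an independent set in every
instance with a linear objective given by non-negative weights. -/
def IsMSPAlgorithm : Prop :=
  ∀ (E : Type u) [Fintype E] (M : Matroid E), M.E = Set.univ → ∀ (lab : E → Λ) (c : E → ℝ),
    (∀ e, 0 ≤ c e) → ∀ (σ : ArrivalOrder E) (ω : A.Seed (Fintype.card E)),
      M.Indep (A.run (mspInstance M lab c) σ ω : Set E)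

/-- `A` is an algorithm for the submodular matroid secretary problem: it accepts an independent set
in every instance with a non-negative submodular objective. -/
def IsSMSPAlgorithm : Prop :=
  ∀ (E : Type u) [Fintype E] (M : Matroid E), M.E = Set.univ → ∀ (lab : E → Λ) (f : Finset E → ℝ),
    IsNonnegSubmodular f → ∀ (σ : ArrivalOrder E) (ω : A.Seed (Fintype.card E)),
      M.Indep (A.run (smspInstance M lab f) σ ω : Set E)

/-- On the matroid `M`, the competitive ratio of `A` for linear objectives is at most `ρ`. -/
def IsMSPCompetitiveOn (M : Matroid E) (lab : E → Λ) (ρ : ℝ) : Prop :=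
  ∀ c : E → ℝ, (∀ e, 0 ≤ c e) →
    (mspInstance M lab c).opt / ρ ≤ A.expectedValue (mspInstance M lab c)

/-- On the matroid `M`, the competitive ratio of `A` for non-negative submodular objectives is at
most `ρ`. -/
def IsSMSPCompetitiveOn (M : Matroid E) (lab : E → Λ) (ρ : ℝ) : Prop :=
  ∀ f : Finset E → ℝ, IsNonnegSubmodular f →
    (smspInstance M lab f).opt / ρ ≤ A.expectedValue (smspInstance M lab f)

open Classical in
/-- For every weight function `c` there are `k` (correlated) random sets `P 0, …, P (k - 1)`, with
joint distribution `D`, such that all of them are always independent in `M`, the expected weight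
of their union is at least the optimum divided by `α`, and the output of `A` is distributed as
`P i` for an index `i` that is uniformly random and independent of the sets. -/
def IsUniformChoiceOn (M : Matroid E) (lab : E → Λ) (k : ℕ) (α : ℝ) : Prop :=
  ∀ c : E → ℝ, (∀ e, 0 ≤ c e) → ∃ D : PMF (Fin k → Finset E),
    (∀ P ∈ D.support, ∀ i, M.Indep (P i : Set E)) ∧
    (mspInstance M lab c).opt / α ≤
      ∑ P : Fin k → Finset E, (D P).toReal * ∑ e ∈ Finset.univ.biUnion P, c e ∧
    ∀ S : Finset E, A.outputProb (mspInstance M lab c) S =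
      (∑ i : Fin k, ∑ P : Fin k → Finset E, if P i = S then (D P).toReal else 0) / k

end OnlineAlgorithm

end MatroidSecretary

open MatroidSecretary

open Finset

namespace MatroidSecretary

/-! The algorithm draws a sample `L` containing each element with probability 1/2 and accepts
nothing from it. Consider the greedy process on all of `E` that always visits the feasible element
of largest positive marginal value over the set `S` kept so far, and keeps it exactly when it lies
in `L`. The marginal value of `u ∉ L` at its visit depends only on `insert u L` (`onlineWeight_eq`),
so it is known when `u` arrives and can serve as a weight. Only elements of `C \ L` retain their
weight, where `C` is a second random set of density `p = 1/(4α)`; all others get weight zero. The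
linear algorithm is run on these weights, and the accepted elements of positive weight are the
output. The sample really arrives first but is shown to the linear algorithm at random virtual
times, and ties are broken by an independent ranking; hence the virtual order is uniform and
independent of the simulated instance (`expectedValue_simulate`).

The process chooses the next element before looking at its coins, so membership in `L` and `C` is
independent of the history (`bernoulliAvg₂_trace`). Let `V` be the visited set, `N` the elements of
`C \ L` visited so far, `F` the mean of `f (V ∩ L)`, and `Z` the mean total marginal value of the
visited elements. Telescoping gives `F - f ∅ = Z/2`. A matroid exchange argument and an adaptive
sampling lemma give `f D ≤ 6F` for independent `D` (`le_six_mul_avg_kept`).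

Two losses remain. First, weights are marginals over `S`, while the output consists of elements of
`N`; for marginals over `S ∪ N`, with mean total `U`, sampling yields `U/2 ≥ (1-p)²F - f ∅`. Second,
the simulated instance must have a large optimum: the visited elements of `C \ L` not spanned by
earlier ones are independent, and the spanned ones account for at most a share `p` of `Z`, by
comparison with the kept elements (`sum_spanned_le`). The guarantee `1/α = 4p` then earns
`2p²(1-p)Z`, against a loss `(p/2)(Z-U)`; with `f ∅` the total is at least `p²(2-3p)F`
(`le_bernoulliAvg₂`). Replacing the union of the `P i` by a random one of them costs the factor `k`,
by subadditivity (`le_sum_outputProb_mul`). -/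

/-- The expectation of `φ L` for a random set `L` that contains each element independently with
probability `q`. -/
noncomputable def bernoulliAvg {E : Type*} [Fintype E] (q : ℝ) (φ : Finset E → ℝ) : ℝ :=
  ∑ L : Finset E, q ^ #L * (1 - q) ^ (Fintype.card E - #L) * φ L

/-! ### Averages over independent coins. -/

section bernoulliAvg

variable {E F : Type*} [Fintype E] [Fintype F] {q : ℝ}

theorem bernoulliAvg_const (q c : ℝ) : bernoulliAvg q (fun _ : Finset E => c) = c := by
  have h := Fintype.sum_pow_mul_eq_add_pow E q (1 - q)
  rw [bernoulliAvg, ← Finset.sum_mul, h]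
  simp

theorem bernoulliAvg_add (φ ψ : Finset E → ℝ) :
    bernoulliAvg q (fun L => φ L + ψ L) = bernoulliAvg q φ + bernoulliAvg q ψ := by
  simp [bernoulliAvg, mul_add, Finset.sum_add_distrib]

theorem bernoulliAvg_sub (φ ψ : Finset E → ℝ) :
    bernoulliAvg q (fun L => φ L - ψ L) = bernoulliAvg q φ - bernoulliAvg q ψ := by
  simp [bernoulliAvg, mul_sub, Finset.sum_sub_distrib]

theorem bernoulliAvg_const_mul (a : ℝ) (φ : Finset E → ℝ) :
    bernoulliAvg q (fun L => a * φ L) = a * bernoulliAvg q φ := by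
  simp only [bernoulliAvg, Finset.mul_sum]
  exact Finset.sum_congr rfl fun _ _ => by ring

theorem bernoulliAvg_mono (h0 : 0 ≤ q) (h1 : q ≤ 1) {φ ψ : Finset E → ℝ} (h : ∀ L, φ L ≤ ψ L) :
    bernoulliAvg q φ ≤ bernoulliAvg q ψ := by
  have : 0 ≤ 1 - q := by linarith
  refine Finset.sum_le_sum fun L _ => mul_le_mul_of_nonneg_left (h L) (by positivity)

theorem bernoulliAvg_map (σ : F ≃ E) (φ : Finset E → ℝ) :
    bernoulliAvg q (fun B : Finset F => φ (B.map σ.toEmbedding)) = bernoulliAvg q φ := by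
  refine Fintype.sum_equiv σ.finsetCongr _ _ fun B => ?_
  simp [Fintype.card_congr σ]

variable [DecidableEq E]

/-- Conditions on the coin of `u`. With `insert` and `erase`, both remaining averages still run over
all subsets, so the identity can be iterated without changing the ground set. -/
theorem bernoulliAvg_split (u : E) (φ : Finset E → ℝ) :
    bernoulliAvg q φ = q * bernoulliAvg q (fun L => φ (insert u L)) +
      (1 - q) * bernoulliAvg q (fun L => φ (L.erase u)) := by
  have key : ∀ ψ : Finset E → ℝ, ∑ L : Finset E, ψ L =
      ∑ L ∈ (univ.erase u).powerset, ψ L + ∑ L ∈ (univ.erase u).powerset, ψ (insert u L) := by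
    intro ψ
    rw [← Finset.sum_powerset_insert (notMem_erase u univ), insert_erase (mem_univ u),
      powerset_univ]
  -- The exponents are truncated differences; naming them `m + 1` and `m` lets `ring` compare them.
  have cards : ∀ L ∈ (univ.erase u).powerset, u ∉ L ∧
      ∃ m, Fintype.card E - #L = m + 1 ∧ Fintype.card E - (#L + 1) = m := by
    intro L hL
    have hu : u ∉ L := fun h => by simpa using mem_powerset.1 hL h
    have : #L < Fintype.card E := Finset.card_lt_univ_of_notMem hu
    exact ⟨hu, Fintype.card E - (#L + 1), by omega, rfl⟩
  simp only [bernoulliAvg, key, Finset.mul_sum, mul_add]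
  rw [← sum_add_distrib, ← sum_add_distrib, ← sum_add_distrib, ← sum_add_distrib]
  refine sum_congr rfl fun L hL => ?_
  obtain ⟨hu, m, h1, h2⟩ := cards L hL
  simp only [card_insert_of_notMem hu, h1, h2, insert_idem, erase_insert hu, erase_eq_of_notMem hu]
  ring

end bernoulliAvg

/-! ### Submodular inequalities. -/

/-- The marginal value of `u` with respect to `S`. -/
def gain {ι : Type*} [DecidableEq ι] (f : Finset ι → ℝ) (S : Finset ι) (u : ι) : ℝ :=
  f (insert u S) - f S

namespace IsNonnegSubmodular

variable {E : Type*} [DecidableEq E] {f : Finset E → ℝ}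

theorem gain_le_gain (hf : IsNonnegSubmodular f) {S T : Finset E} (hST : S ⊆ T) {u : E}
    (hu : u ∉ T) : gain f T u ≤ gain f S u := by
  have h := hf.2 S T hST u hu
  unfold gain
  convert h

/-- Allowing `u ∈ S`, where both insertions are trivial, spares later inductions from tracking
disjointness from a fixed set. -/
theorem insert_add_le (hf : IsNonnegSubmodular f) {S T : Finset E} (hST : S ⊆ T) {u : E}
    (hu : u ∈ T → u ∈ S) : f S + f (insert u T) ≤ f (insert u S) + f T := by
  by_cases h : u ∈ T
  · rw [insert_eq_of_mem h, insert_eq_of_mem (hu h)]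
  · have := hf.gain_le_gain hST h
    unfold gain at this
    linarith

theorem union_le_add_sum_gain (hf : IsNonnegSubmodular f) (S T : Finset E) :
    f (S ∪ T) ≤ f S + ∑ u ∈ T \ S, gain f S u := by
  rw [← union_sdiff_self_eq_union]
  have hd : Disjoint S (T \ S) := disjoint_sdiff
  generalize T \ S = D at hd
  induction D using Finset.induction_on with
  | empty => simp
  | insert a D ha ih =>
    rw [disjoint_insert_right] at hd
    have h := hf.gain_le_gain (subset_union_left : S ⊆ S ∪ D) (u := a)
      (by simp [ha, hd.1])
    rw [sum_insert ha, union_insert]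
    unfold gain at h ⊢
    have := ih hd.2
    unfold gain at this
    linarith

/-- Adding `T \ S` one element at a time gains no more over `S` than over `S ∩ T`. -/
theorem union_add_inter_le (hf : IsNonnegSubmodular f) (S T : Finset E) :
    f (S ∪ T) + f (S ∩ T) ≤ f S + f T := by
  have key : ∀ D : Finset E, Disjoint S D → f (S ∪ D) + f (S ∩ T) ≤ f S + f ((S ∩ T) ∪ D) := by
    intro D hD
    induction D using Finset.induction_on with
    | empty => simp
    | insert a D ha ih =>
      rw [disjoint_insert_right] at hD
      have h := hf.gain_le_gain (u := a)
        (union_subset_union_left inter_subset_left : (S ∩ T) ∪ D ⊆ S ∪ D) (by simp [ha, hD.1])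
      have := ih hD.2
      rw [union_insert, union_insert]
      unfold gain at h
      linarith
  have h := key (T \ S) disjoint_sdiff
  rwa [union_sdiff_self_eq_union, inter_comm S T, union_comm (T ∩ S), sdiff_union_inter,
    inter_comm T S] at h

theorem union_le_add (hf : IsNonnegSubmodular f) (S T : Finset E) : f (S ∪ T) ≤ f S + f T := by
  have := hf.union_add_inter_le S T
  have := hf.1 (S ∩ T)
  linarith

theorem biUnion_le_sum (hf : IsNonnegSubmodular f) {κ : Type*} {s : Finset κ} (hs : s.Nonempty)
    (P : κ → Finset E) : f (s.biUnion P) ≤ ∑ i ∈ s, f (P i) := by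
  classical
  induction hs using Finset.Nonempty.cons_induction with
  | singleton a => simp
  | cons a s ha hs ih =>
    rw [cons_eq_insert, biUnion_insert, sum_insert ha]
    exact (hf.union_le_add _ _).trans (by linarith)

variable [Fintype E] {q : ℝ}

/-- The sampling lemma of Feige, Mirrokni and Vondrák. -/
theorem le_bernoulliAvg (hf : IsNonnegSubmodular f) (h0 : 0 ≤ q) (h1 : q ≤ 1) (A K : Finset E) :
    (1 - q) * f A + q * f (A ∪ K) ≤ bernoulliAvg q (fun C => f (A ∪ (K ∩ C))) := by
  induction K using Finset.induction_on generalizing A with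
  | empty => simp only [empty_inter, union_empty, bernoulliAvg_const]; linarith
  | insert u K hu ih =>
    rw [bernoulliAvg_split u]
    have e1 : ∀ C, A ∪ (insert u K ∩ insert u C) = insert u A ∪ (K ∩ C) := by
      intro C; ext x; simp only [mem_union, mem_inter, mem_insert]; tauto
    have e2 : ∀ C : Finset E, A ∪ (insert u K ∩ C.erase u) = A ∪ (K ∩ C) := by
      intro C; ext x; simp only [mem_union, mem_inter, mem_insert, mem_erase]
      by_cases hx : x = u
      · subst hx; simp [hu]
      · simp [hx]
    simp only [e1, e2]
    have i1 := ih (insert u A)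
    have i2 := ih A
    have h := hf.insert_add_le (subset_union_left : A ⊆ A ∪ K) (u := u) (by simp [hu])
    rw [insert_union] at i1
    rw [union_insert]
    have hq : 0 ≤ 1 - q := by linarith
    have a1 := mul_le_mul_of_nonneg_left i1 h0
    have a2 := mul_le_mul_of_nonneg_left i2 hq
    have a3 := mul_le_mul_of_nonneg_left h (mul_nonneg h0 hq)
    linarith

end IsNonnegSubmodular

/-! ### The greedy process and its invariance properties. -/

section greedy

variable {ι κ : Type*} [DecidableEq ι] [DecidableEq κ]

/-- The greedy algorithm may add `u` to `S`. -/
def Eligible (f : Finset ι → ℝ) (I : Finset ι → Prop) (S : Finset ι) (u : ι) : Prop :=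
  I (insert u S) ∧ 0 < gain f S u

/-- `x` is the eligible element of `T` of largest marginal value; ties are broken by `r`. -/
def IsBest (f : Finset ι → ℝ) (I : Finset ι → Prop) (r : ι ↪ ℕ) (S T : Finset ι) (x : ι) : Prop :=
  x ∈ T ∧ Eligible f I S x ∧
    ∀ y ∈ T, Eligible f I S y → gain f S y < gain f S x ∨ gain f S y = gain f S x ∧ r y ≤ r x

open Classical in
/-- The element of `T` that the greedy algorithm adds to `S`, if there is one. -/
noncomputable def best (f : Finset ι → ℝ) (I : Finset ι → Prop) (r : ι ↪ ℕ) (S T : Finset ι) :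
    Option ι :=
  if h : ∃ x, IsBest f I r S T x then some h.choose else none

variable {f : Finset ι → ℝ} {I : Finset ι → Prop} {r : ι ↪ ℕ} {L S T : Finset ι} {x u : ι}

theorem IsBest.gain_le (h : IsBest f I r S T x) (hu : u ∈ T) (he : Eligible f I S u) :
    gain f S u ≤ gain f S x := by
  rcases h.2.2 u hu he with h | h
  · exact h.le
  · exact h.1.le

theorem IsBest.unique {y : ι} (hx : IsBest f I r S T x) (hy : IsBest f I r S T y) : x = y := by
  have h1 := hx.2.2 y hy.1 hy.2.1
  have h2 := hy.2.2 x hx.1 hx.2.1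
  apply r.injective
  rcases h1 with h1 | h1 <;> rcases h2 with h2 | h2
  · linarith
  · linarith [h2.1]
  · linarith [h1.1]
  · exact le_antisymm h2.2 h1.2

theorem exists_isBest (hu : u ∈ T) (he : Eligible f I S u) : ∃ x, IsBest f I r S T x := by
  classical
  obtain ⟨x, hx, hmax⟩ := (T.filter (Eligible f I S)).exists_max_image
    (fun y => toLex (gain f S y, r y)) ⟨u, by simp [hu, he]⟩
  rw [mem_filter] at hx
  refine ⟨x, hx.1, hx.2, fun y hy hey => ?_⟩
  have := hmax y (mem_filter.2 ⟨hy, hey⟩)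
  rwa [Prod.Lex.toLex_le_toLex] at this

theorem best_eq_some_iff : best f I r S T = some x ↔ IsBest f I r S T x := by
  unfold best
  split_ifs with h
  · rw [Option.some.injEq]
    exact ⟨fun hx => hx ▸ h.choose_spec, fun hx => h.choose_spec.unique hx⟩
  · simpa using fun hx => h ⟨x, hx⟩

theorem best_eq_none_iff : best f I r S T = none ↔ ∀ y ∈ T, ¬ Eligible f I S y := by
  unfold best
  split_ifs with h
  · simp only [false_iff]
    intro hn
    exact hn _ h.choose_spec.1 h.choose_spec.2.1
  · simp only [true_iff]
    exact fun y hy he => h (exists_isBest hy he)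

theorem IsBest.subset (h : IsBest f I r S T x) {T' : Finset ι} (hT : T' ⊆ T) (hx : x ∈ T') :
    IsBest f I r S T' x :=
  ⟨hx, h.2.1, fun y hy => h.2.2 y (hT hy)⟩

variable (f I r L) in
/-- The greedy process on `T`, starting from the set `S`, keeps an element that it visits if this
element belongs to `L` and discards it otherwise.  This is the marginal value of `u` at the time
when the process visits `u`, and zero if it does not visit `u`.  The process stops after the given
number of steps. -/
noncomputable def visitGain : ℕ → Finset ι → Finset ι → ι → ℝ
  | 0, _, _, _ => 0
  | n + 1, S, T, u =>
    match best f I r S T with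
    | none => 0
    | some x =>
      if u = x then gain f S x
      else visitGain n (if x ∈ L then insert x S else S) (T.erase x) u

variable (f I r L) in
/-- The set of elements that the greedy process visits. -/
noncomputable def visited : ℕ → Finset ι → Finset ι → Finset ι
  | 0, _, _ => ∅
  | n + 1, S, T =>
    match best f I r S T with
    | none => ∅
    | some x => insert x (visited n (if x ∈ L then insert x S else S) (T.erase x))

variable (f I r L) in
/-- The elements that the greedy process visits, each together with the sets of elements of `L`,
and of `C \ L`, that have been visited before. -/
noncomputable def trace (C : Finset ι) : ℕ → Finset ι → Finset ι → Finset ι →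
    List (ι × Finset ι × Finset ι)
  | 0, _, _, _ => []
  | n + 1, S, N, T =>
    match best f I r S T with
    | none => []
    | some x => (x, S, N) :: trace C n (if x ∈ L then insert x S else S)
        (if x ∉ L ∧ x ∈ C then insert x N else N) (T.erase x)

section steps

variable {n : ℕ} {N C : Finset ι}

theorem visitGain_none (h : best f I r S T = none) : visitGain f I r L n S T u = 0 := by
  cases n <;> simp [visitGain, h]

theorem visitGain_some (h : best f I r S T = some x) : visitGain f I r L (n + 1) S T u =
    if u = x then gain f S x
    else visitGain f I r L n (if x ∈ L then insert x S else S) (T.erase x) u := by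
  rw [visitGain, h]

theorem visited_none (h : best f I r S T = none) : visited f I r L n S T = ∅ := by
  cases n <;> simp [visited, h]

theorem visited_some (h : best f I r S T = some x) : visited f I r L (n + 1) S T =
    insert x (visited f I r L n (if x ∈ L then insert x S else S) (T.erase x)) := by
  rw [visited, h]

theorem trace_none (h : best f I r S T = none) : trace f I r L C n S N T = [] := by
  cases n <;> simp [trace, h]

theorem trace_some (h : best f I r S T = some x) : trace f I r L C (n + 1) S N T =
    (x, S, N) :: trace f I r L C n (if x ∈ L then insert x S else S)
        (if x ∉ L ∧ x ∈ C then insert x N else N) (T.erase x) := by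
  rw [trace, h]

theorem visited_subset : visited f I r L n S T ⊆ T := by
  induction n generalizing S T with
  | zero => simp [visited]
  | succ n ih =>
    cases hb : best f I r S T with
    | none => simp [visited_none hb]
    | some x =>
      rw [visited_some hb]
      exact insert_subset (best_eq_some_iff.1 hb).1 (ih.trans (erase_subset _ _))

/-- Eligible elements have positive marginal value, so the weight alone reveals whether an element
is visited. -/
theorem mem_visited_iff : u ∈ visited f I r L n S T ↔ 0 < visitGain f I r L n S T u := by
  induction n generalizing S T with
  | zero => simp [visited, visitGain]
  | succ n ih =>
    cases hb : best f I r S T with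
    | none => simp [visited_none hb, visitGain_none hb]
    | some x =>
      rw [visited_some hb, visitGain_some hb, mem_insert, ih]
      by_cases h : u = x
      · simp [h, (best_eq_some_iff.1 hb).2.1.2]
      · simp [h]

theorem visitGain_nonneg : 0 ≤ visitGain f I r L n S T u := by
  induction n generalizing S T with
  | zero => simp [visitGain]
  | succ n ih =>
    cases hb : best f I r S T with
    | none => simp [visitGain_none hb]
    | some x =>
      rw [visitGain_some hb]
      split_ifs with h
      · exact (best_eq_some_iff.1 hb).2.1.2.le
      · exact ih
      · exact ih

theorem visitGain_of_notMem (h : u ∉ visited f I r L n S T) : visitGain f I r L n S T u = 0 :=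
  le_antisymm (not_lt.1 fun h' => h (mem_visited_iff.2 h')) visitGain_nonneg

/-- Discarding in advance elements that the process discards anyway changes nothing. -/
theorem visitGain_eq_of_subset {m : ℕ} {T' : Finset ι} (hT : T' ⊆ T)
    (hL : ∀ y ∈ T, y ∈ L → y ∈ T') (hu : u ∈ T') (hn : #T ≤ n) (hm : #T' ≤ m) :
    visitGain f I r L n S T u = visitGain f I r L m S T' u := by
  induction n generalizing S T T' m with
  | zero =>
    have : #T' = 0 := by have := card_le_card hT; omega
    simp_all
  | succ n ih =>
    cases hb : best f I r S T with
    | none =>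
      have hb' : best f I r S T' = none :=
        best_eq_none_iff.2 fun y hy => best_eq_none_iff.1 hb y (hT hy)
      rw [visitGain_none hb, visitGain_none hb']
    | some x =>
      have hx := best_eq_some_iff.1 hb
      have hc : #(T.erase x) ≤ n := by rw [card_erase_of_mem hx.1]; omega
      rw [visitGain_some hb]
      by_cases hxT : x ∈ T'
      · have hb' : best f I r S T' = some x := best_eq_some_iff.2 (hx.subset hT hxT)
        obtain ⟨m, rfl⟩ : ∃ m', m = m' + 1 := ⟨m - 1, by
          have := card_pos.2 ⟨x, hxT⟩
          omega⟩
        rw [visitGain_some hb']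
        split_ifs with h h'
        · rfl
        all_goals
          refine ih (erase_subset_erase _ hT) ?_ (mem_erase.2 ⟨h, hu⟩) hc ?_
          · intro y hy hyL
            rw [mem_erase] at hy ⊢
            exact ⟨hy.1, hL y hy.2 hyL⟩
          · rw [card_erase_of_mem hxT]; omega
      -- An element missing from `T'` is not in `L`: the larger process discards it and continues
      -- with the same `S`, while the smaller one makes no step.
      · have hxL : x ∉ L := fun h => hxT (hL x hx.1 h)
        rw [if_neg (by rintro rfl; exact hxT hu), if_neg hxL]
        refine ih (subset_erase.2 ⟨hT, hxT⟩) ?_ hu hc hm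
        exact fun y hy => hL y (mem_of_mem_erase hy)

theorem gain_map (e : κ ↪ ι) (A : Finset κ) (v : κ) :
    gain (fun B => f (B.map e)) A v = gain f (A.map e) (e v) := by
  simp [gain, map_insert]

theorem isBest_map (e : κ ↪ ι) {A B : Finset κ} {v : κ} :
    IsBest (fun B => f (B.map e)) (fun B => I (B.map e)) (e.trans r) A B v ↔
      IsBest f I r (A.map e) (B.map e) (e v) := by
  simp [IsBest, Eligible, gain_map, map_insert]

theorem best_map (e : κ ↪ ι) (A B : Finset κ) :
    best f I r (A.map e) (B.map e) =
      (best (fun B => f (B.map e)) (fun B => I (B.map e)) (e.trans r) A B).map e := by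
  cases hb : best (fun B => f (B.map e)) (fun B => I (B.map e)) (e.trans r) A B with
  | none =>
    rw [best_eq_none_iff] at hb
    simp only [Option.map_none, best_eq_none_iff, mem_map]
    rintro _ ⟨y, hy, rfl⟩
    have := hb y hy
    simpa [Eligible, gain_map, map_insert] using this
  | some v =>
    rw [best_eq_some_iff, isBest_map] at hb
    exact best_eq_some_iff.2 hb

/-- The process evaluates `f`, `I` and `r` only on elements of its ground set, so it commutes with
relabelling. An online algorithm, which knows elements only by arrival position, can thus compute
the weights. -/
theorem visitGain_map (e : κ ↪ ι) (K A B : Finset κ) (v : κ) :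
    visitGain f I r (K.map e) n (A.map e) (B.map e) (e v) =
      visitGain (fun B => f (B.map e)) (fun B => I (B.map e)) (e.trans r) K n A B v := by
  induction n generalizing A B with
  | zero => rfl
  | succ n ih =>
    have h := best_map (f := f) (I := I) (r := r) e A B
    cases hb : best (fun B => f (B.map e)) (fun B => I (B.map e)) (e.trans r) A B with
    | none =>
      rw [hb] at h
      rw [visitGain_none hb, visitGain_none h]
    | some y =>
      rw [hb] at h
      rw [visitGain_some hb, visitGain_some h]
      simp only [EmbeddingLike.apply_eq_iff_eq, mem_map', ← map_insert, ← map_erase, gain_map,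
        ← apply_ite (fun X : Finset κ => X.map e), ih]

end steps

end greedy

/-! ### The history of the process: telescoping sums and monotonicity. -/

section trace

variable {ι : Type*} [DecidableEq ι] {f : Finset ι → ℝ} {I : Finset ι → Prop} {r : ι ↪ ℕ}
  {L C S T N : Finset ι} {x u : ι} {n : ℕ}

theorem disjoint_ite_insert_erase {p : Prop} [Decidable p] (h : Disjoint S T) :
    Disjoint (if p then insert x S else S) (T.erase x) := by
  have h' : Disjoint S (T.erase x) := h.mono_right (erase_subset _ _)
  split_ifs
  · simp [disjoint_insert_left, h']
  · exact h'

theorem subset_ite_insert {p : Prop} [Decidable p] : S ⊆ if p then insert x S else S := by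
  split_ifs
  · exact subset_insert _ _
  · exact Subset.rfl

theorem Eligible.anti (hf : IsNonnegSubmodular f) (hI : ∀ A B, A ⊆ B → I B → I A)
    {A B : Finset ι} (hAB : A ⊆ B) (hu : u ∉ B) (h : Eligible f I B u) : Eligible f I A u :=
  ⟨hI _ _ (insert_subset_insert u hAB) h.1, h.2.trans_le (hf.gain_le_gain hAB hu)⟩

/-- The sets `S` and `N` grow along the process, but absorb only elements that have just been erased
from `T`. -/
theorem mem_of_mem_trace (hS : Disjoint S T) (hN : Disjoint N T) {t : ι × Finset ι × Finset ι}
    (ht : t ∈ trace f I r L C n S N T) :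
    t.1 ∈ T ∧ t.1 ∉ t.2.1 ∧ t.1 ∉ t.2.2 ∧ S ⊆ t.2.1 ∧ N ⊆ t.2.2 ∧ Eligible f I t.2.1 t.1 := by
  induction n generalizing S N T with
  | zero => simp [trace] at ht
  | succ n ih =>
    cases hb : best f I r S T with
    | none => simp [trace_none hb] at ht
    | some x =>
      have hx := best_eq_some_iff.1 hb
      rw [trace_some hb, List.mem_cons] at ht
      rcases ht with rfl | ht
      · exact ⟨hx.1, fun h => disjoint_left.1 hS h hx.1, fun h => disjoint_left.1 hN h hx.1,
          Subset.rfl, Subset.rfl, hx.2.1⟩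
      · obtain ⟨h1, h2, h3, h4, h5, h6⟩ :=
          ih (disjoint_ite_insert_erase hS) (disjoint_ite_insert_erase hN) ht
        exact ⟨mem_of_mem_erase h1, h2, h3, subset_ite_insert.trans h4, subset_ite_insert.trans h5,
          h6⟩

theorem mem_map_fst_trace : u ∈ (trace f I r L C n S N T).map Prod.fst ↔
    u ∈ visited f I r L n S T := by
  induction n generalizing S N T with
  | zero => simp [trace, visited]
  | succ n ih =>
    cases hb : best f I r S T with
    | none => simp [trace_none hb, visited_none hb]
    | some x => rw [trace_some hb, visited_some hb, List.map_cons, List.mem_cons, mem_insert, ih]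

theorem nodup_map_fst_trace : ((trace f I r L C n S N T).map Prod.fst).Nodup := by
  induction n generalizing S N T with
  | zero => simp [trace]
  | succ n ih =>
    cases hb : best f I r S T with
    | none => simp [trace_none hb]
    | some x =>
      rw [trace_some hb, List.map_cons, List.nodup_cons, mem_map_fst_trace]
      exact ⟨fun h => notMem_erase x T (visited_subset h), ih⟩

theorem visitGain_eq_gain {t : ι × Finset ι × Finset ι} (ht : t ∈ trace f I r L C n S N T) :
    visitGain f I r L n S T t.1 = gain f t.2.1 t.1 := by
  induction n generalizing S N T with
  | zero => simp [trace] at ht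
  | succ n ih =>
    cases hb : best f I r S T with
    | none => simp [trace_none hb] at ht
    | some x =>
      rw [trace_some hb, List.mem_cons] at ht
      rw [visitGain_some hb]
      rcases ht with rfl | ht
      · simp
      · have : t.1 ∈ T.erase x :=
          visited_subset (mem_map_fst_trace.1 (List.mem_map_of_mem (f := Prod.fst) ht))
        rw [if_neg (ne_of_mem_erase this), ih ht]

open Classical in
/-- The visited elements with the property `P`. -/
noncomputable def traceFilter (l : List (ι × Finset ι × Finset ι))
    (P : ι × Finset ι × Finset ι → Prop) : Finset ι :=
  ((l.filter P).map Prod.fst).toFinset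

theorem mem_traceFilter {l : List (ι × Finset ι × Finset ι)} {P : ι × Finset ι × Finset ι → Prop} :
    u ∈ traceFilter l P ↔ ∃ t ∈ l, P t ∧ t.1 = u := by
  simp [traceFilter, and_assoc]

theorem sum_traceFilter (P : ι × Finset ι × Finset ι → Prop) [DecidablePred P] :
    ∑ u ∈ traceFilter (trace f I r L C n S N T) P, visitGain f I r L n S T u =
      ((trace f I r L C n S N T).map fun t => if P t then gain f t.2.1 t.1 else 0).sum := by
  rw [traceFilter, List.sum_toFinset, List.map_map]
  · have : ∀ l : List (ι × Finset ι × Finset ι),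
        (∀ t ∈ l, visitGain f I r L n S T t.1 = gain f t.2.1 t.1) →
        ((l.filter fun t => @decide (P t) (Classical.propDecidable _)).map
          (visitGain f I r L n S T ∘ Prod.fst)).sum =
          (l.map fun t => if P t then gain f t.2.1 t.1 else 0).sum := by
      intro l hl
      induction l with
      | nil => rfl
      | cons a l ih =>
        have := hl a List.mem_cons_self
        by_cases h : P a
        · rw [List.filter_cons_of_pos (by simpa using h), List.map_cons, List.map_cons,
            List.sum_cons, List.sum_cons, if_pos h, ih fun t ht => hl t (List.mem_cons_of_mem _ ht)]
          simp [this]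
        · rw [List.filter_cons_of_neg (by simpa using h), List.map_cons, List.sum_cons, if_neg h,
            zero_add, ih fun t ht => hl t (List.mem_cons_of_mem _ ht)]
    exact this _ fun t ht => visitGain_eq_gain ht
  · exact nodup_map_fst_trace.sublist (List.filter_sublist.map _)

theorem sum_visited_inter (X : Finset ι) :
    ∑ u ∈ visited f I r L n S T ∩ X, visitGain f I r L n S T u =
      ((trace f I r L C n S N T).map fun t => if t.1 ∈ X then gain f t.2.1 t.1 else 0).sum := by
  have := sum_traceFilter (f := f) (I := I) (r := r) (L := L) (C := C) (n := n) (S := S) (N := N)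
    (T := T) (fun t => t.1 ∈ X)
  convert this using 2
  · ext u
    simp only [mem_inter, mem_traceFilter, ← mem_map_fst_trace (C := C) (N := N), List.mem_map]
    constructor
    · rintro ⟨⟨t, ht, rfl⟩, hu⟩
      exact ⟨t, ht, hu, rfl⟩
    · rintro ⟨t, ht, hu, rfl⟩
      exact ⟨⟨t, ht, rfl⟩, hu⟩

/-- The marginal values of the elements that are kept add up. -/
theorem sum_gain_kept :
    ((trace f I r L C n S N T).map fun t => if t.1 ∈ L then gain f t.2.1 t.1 else 0).sum =
      f (S ∪ visited f I r L n S T ∩ L) - f S := by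
  induction n generalizing S N T with
  | zero => simp [trace, visited]
  | succ n ih =>
    cases hb : best f I r S T with
    | none => simp [trace_none hb, visited_none hb]
    | some x =>
      rw [trace_some hb, visited_some hb, List.map_cons, List.sum_cons, ih]
      by_cases hx : x ∈ L
      · simp [hx, insert_inter_of_mem, gain]
      · simp [hx, insert_inter_of_notMem]

/-- Telescopes, because a visited element joins `S ∪ N` exactly when it lies in `L` or in `C`. -/
theorem sum_gain_union :
    ((trace f I r L C n S N T).map fun t =>
        if t.1 ∈ L ∨ t.1 ∈ C then gain f (t.2.1 ∪ t.2.2) t.1 else 0).sum =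
      f ((S ∪ visited f I r L n S T ∩ L) ∪ (N ∪ visited f I r L n S T ∩ (C \ L))) - f (S ∪ N) := by
  induction n generalizing S N T with
  | zero => simp [trace, visited]
  | succ n ih =>
    cases hb : best f I r S T with
    | none => simp [trace_none hb, visited_none hb]
    | some x =>
      rw [trace_some hb, visited_some hb, List.map_cons, List.sum_cons, ih]
      by_cases hx : x ∈ L
      · simp [hx, insert_inter_of_mem, insert_inter_of_notMem, gain]
      · by_cases hC : x ∈ C
        · simp [hx, hC, insert_inter_of_mem, insert_inter_of_notMem, gain]
        · simp [hx, hC, insert_inter_of_notMem]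

/-- The right side telescopes over the elements of `R` that join `N`; each increment is a marginal
over `R ∩ N`, which is contained in `S ∪ N`. -/
theorem sum_gain_le (hf : IsNonnegSubmodular f) (hS : Disjoint S T) (hN : Disjoint N T)
    (R : Finset ι) :
    ((trace f I r L C n S N T).map fun t =>
        if t.1 ∈ R ∩ (C \ L) then gain f (t.2.1 ∪ t.2.2) t.1 else 0).sum ≤
      f (R ∩ (N ∪ visited f I r L n S T ∩ (C \ L))) - f (R ∩ N) := by
  induction n generalizing S N T with
  | zero => simp [trace, visited]
  | succ n ih =>
    cases hb : best f I r S T with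
    | none => simp [trace_none hb, visited_none hb]
    | some x =>
      have hx := (best_eq_some_iff.1 hb).1
      have := ih (disjoint_ite_insert_erase hS (p := x ∈ L) (x := x))
        (disjoint_ite_insert_erase hN (p := x ∉ L ∧ x ∈ C) (x := x))
      rw [trace_some hb, visited_some hb, List.map_cons, List.sum_cons]
      by_cases hxC : x ∈ C \ L
      · have hxC' : x ∉ L ∧ x ∈ C := (mem_sdiff.1 hxC).symm
        rw [if_pos hxC', insert_union] at this
        rw [if_pos hxC', insert_inter_of_mem hxC, union_insert]
        by_cases hxR : x ∈ R
        · rw [if_pos (mem_inter.2 ⟨hxR, hxC⟩)]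
          rw [inter_insert_of_mem hxR, inter_insert_of_mem hxR] at this
          rw [inter_insert_of_mem hxR]
          have hg := hf.gain_le_gain
            (inter_subset_right.trans subset_union_right : R ∩ N ⊆ S ∪ N) (u := x)
            (by simp [disjoint_right.1 hS hx, disjoint_right.1 hN hx])
          have e : gain f (R ∩ N) x = f (insert x (R ∩ N)) - f (R ∩ N) := rfl
          linarith
        · rw [if_neg (by simp [hxR])]
          rw [inter_insert_of_notMem hxR, inter_insert_of_notMem hxR] at this
          rw [inter_insert_of_notMem hxR]
          linarith
      · have h1 : ¬ (x ∉ L ∧ x ∈ C) := by simpa [and_comm] using hxC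
        rw [if_neg h1] at this
        rw [if_neg (by simp [hxC]), if_neg h1, insert_inter_of_notMem hxC]
        linarith

/-- The process visits the elements in the order of their marginal values. -/
theorem gain_le_visitGain_of_mem (hf : IsNonnegSubmodular f) (hI : ∀ A B, A ⊆ B → I B → I A)
    (hS : Disjoint S T) (hN : Disjoint N T) {t : ι × Finset ι × Finset ι}
    (ht : t ∈ trace f I r L C n S N T) {b : ι} (hb : b ∈ t.2.2) :
    b ∈ N ∨ b ∈ visited f I r L n S T ∩ (C \ L) ∧
      gain f t.2.1 t.1 ≤ visitGain f I r L n S T b := by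
  induction n generalizing S N T with
  | zero => simp [trace] at ht
  | succ n ih =>
    cases hx : best f I r S T with
    | none => simp [trace_none hx] at ht
    | some x =>
      rw [trace_some hx, List.mem_cons] at ht
      rw [visitGain_some hx, visited_some hx]
      rcases ht with rfl | ht
      · exact Or.inl hb
      · have hx' := best_eq_some_iff.1 hx
        have hS' := disjoint_ite_insert_erase hS (p := x ∈ L) (x := x)
        have hN' := disjoint_ite_insert_erase hN (p := x ∉ L ∧ x ∈ C) (x := x)
        obtain ⟨m1, m2, m3, m4, m5, m6⟩ := mem_of_mem_trace hS' hN' ht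
        rcases ih hS' hN' ht with h | ⟨h, h'⟩
        · split_ifs at h with hxx
          · rw [mem_insert] at h
            rcases h with rfl | h
            · right
              have hA : S ⊆ t.2.1 := subset_ite_insert.trans m4
              refine ⟨by simp [hxx], ?_⟩
              rw [if_pos rfl]
              -- When `b` was visited, `t.1` was still available, and eligible because eligibility
              -- passes to smaller sets; the greedy choice of `b` then bounds its marginal value.
              exact (hf.gain_le_gain hA m2).trans
                (hx'.gain_le (mem_of_mem_erase m1) (m6.anti hf hI hA m2))
            · exact Or.inl h
          · exact Or.inl h
        · right
          have hbx : b ≠ x := ne_of_mem_erase (visited_subset (mem_inter.1 h).1)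
          refine ⟨mem_inter.2 ⟨mem_insert_of_mem (mem_inter.1 h).1, (mem_inter.1 h).2⟩, ?_⟩
          rwa [if_neg hbx]

/-- The process consults `L` and `C` only on `T`. After `x` has been erased its coins can therefore
be reset, which keeps the coin-by-coin inductions going. -/
theorem trace_congr {L' C' : Finset ι} (hL : ∀ y ∈ T, y ∈ L ↔ y ∈ L') (hC : ∀ y ∈ T, y ∈ C ↔ y ∈ C') :
    trace f I r L C n S N T = trace f I r L' C' n S N T := by
  induction n generalizing S N T with
  | zero => rfl
  | succ n ih =>
    cases hb : best f I r S T with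
    | none => rw [trace_none hb, trace_none hb]
    | some x =>
      have hx := (best_eq_some_iff.1 hb).1
      rw [trace_some hb, trace_some hb, ih (fun y hy => hL y (mem_of_mem_erase hy))
        fun y hy => hC y (mem_of_mem_erase hy)]
      simp only [hL x hx, hC x hx]

theorem visited_congr {L' : Finset ι} (hL : ∀ y ∈ T, y ∈ L ↔ y ∈ L') :
    visited f I r L n S T = visited f I r L' n S T := by
  ext u
  rw [← mem_map_fst_trace (C := ∅) (N := ∅), ← mem_map_fst_trace (C := ∅) (N := ∅),
    trace_congr hL fun _ _ => Iff.rfl]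

theorem subset_kept {t : ι × Finset ι × Finset ι} (ht : t ∈ trace f I r L C n S N T) :
    t.2.1 ⊆ S ∪ visited f I r L n S T ∩ L := by
  induction n generalizing S N T with
  | zero => simp [trace] at ht
  | succ n ih =>
    cases hb : best f I r S T with
    | none => simp [trace_none hb] at ht
    | some x =>
      rw [trace_some hb, List.mem_cons] at ht
      rw [visited_some hb]
      rcases ht with rfl | ht
      · exact subset_union_left
      · refine (ih ht).trans ?_
        by_cases hx : x ∈ L
        · simp [hx, insert_inter_of_mem]
        · simp [hx, insert_inter_of_notMem]

end trace

/-! ### The process under random `L` and `C`. -/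

section average

variable {E : Type*} [Fintype E] {p q : ℝ}

/-- The expectation of `Φ L C` for independent random sets `L` and `C` that contain each element
with probability `q` and `p`, respectively. -/
noncomputable def bernoulliAvg₂ (q p : ℝ) (Φ : Finset E → Finset E → ℝ) : ℝ :=
  bernoulliAvg q fun L => bernoulliAvg p fun C => Φ L C

theorem bernoulliAvg₂_add (Φ Ψ : Finset E → Finset E → ℝ) :
    bernoulliAvg₂ q p (fun L C => Φ L C + Ψ L C) = bernoulliAvg₂ q p Φ + bernoulliAvg₂ q p Ψ := by
  simp only [bernoulliAvg₂, bernoulliAvg_add]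

theorem bernoulliAvg₂_sub (Φ Ψ : Finset E → Finset E → ℝ) :
    bernoulliAvg₂ q p (fun L C => Φ L C - Ψ L C) = bernoulliAvg₂ q p Φ - bernoulliAvg₂ q p Ψ := by
  simp only [bernoulliAvg₂, bernoulliAvg_sub]

theorem bernoulliAvg₂_const_mul (a : ℝ) (Φ : Finset E → Finset E → ℝ) :
    bernoulliAvg₂ q p (fun L C => a * Φ L C) = a * bernoulliAvg₂ q p Φ := by
  simp only [bernoulliAvg₂, bernoulliAvg_const_mul]

theorem bernoulliAvg₂_const (c : ℝ) : bernoulliAvg₂ q p (fun _ _ : Finset E => c) = c := by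
  simp only [bernoulliAvg₂, bernoulliAvg_const]

theorem bernoulliAvg₂_mono (hq0 : 0 ≤ q) (hq1 : q ≤ 1) (hp0 : 0 ≤ p) (hp1 : p ≤ 1)
    {Φ Ψ : Finset E → Finset E → ℝ} (h : ∀ L C, Φ L C ≤ Ψ L C) :
    bernoulliAvg₂ q p Φ ≤ bernoulliAvg₂ q p Ψ :=
  bernoulliAvg_mono hq0 hq1 fun L => bernoulliAvg_mono hp0 hp1 fun C => h L C

variable [DecidableEq E] {f : Finset E → ℝ} {I : Finset E → Prop}
  {r : E ↪ ℕ} {S T N : Finset E} {n : ℕ}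

/-- An adaptive form of the sampling lemma: which elements are offered depends on earlier coins, so
no fixed set is being sampled, and the witness `A` is built by induction. In the application only `0
≤ f (D ∪ S ∪ A)` matters. -/
theorem exists_le_bernoulliAvg_kept (hf : IsNonnegSubmodular f) (h0 : 0 ≤ q) (h1 : q ≤ 1)
    (D : Finset E) : ∃ A ⊆ T, (1 - q) * f (D ∪ S) + q * f (D ∪ S ∪ A) ≤
      bernoulliAvg q fun L => f (D ∪ (S ∪ visited f I r L n S T ∩ L)) := by
  induction n generalizing S T with
  | zero =>
    refine ⟨∅, empty_subset _, ?_⟩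
    simp only [visited, empty_inter, union_empty, bernoulliAvg_const]
    linarith
  | succ n ih =>
    cases hb : best f I r S T with
    | none =>
      refine ⟨∅, empty_subset _, ?_⟩
      simp only [visited_none hb, empty_inter, union_empty, bernoulliAvg_const]
      linarith
    | some x =>
      have hx := (best_eq_some_iff.1 hb).1
      have e1 : ∀ L, D ∪ (S ∪ visited f I r (insert x L) (n + 1) S T ∩ insert x L) =
          D ∪ (insert x S ∪ visited f I r L n (insert x S) (T.erase x) ∩ L) := by
        intro L
        rw [visited_some hb, if_pos (mem_insert_self x L), visited_congr (L' := L)]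
        · ext y
          simp only [mem_union, mem_inter, mem_insert]
          tauto
        · intro y hy
          simp [ne_of_mem_erase hy]
      have e2 : ∀ L : Finset E, D ∪ (S ∪ visited f I r (L.erase x) (n + 1) S T ∩ L.erase x) =
          D ∪ (S ∪ visited f I r L n S (T.erase x) ∩ L) := by
        intro L
        rw [visited_some hb, if_neg (notMem_erase x L), visited_congr (L' := L)]
        · have : x ∉ visited f I r L n S (T.erase x) :=
            fun h => notMem_erase x T (visited_subset h)
          ext y
          by_cases hy : y = x
          · subst hy; simp [this]
          · simp [hy]
        · intro y hy
          simp [ne_of_mem_erase hy]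
      rw [bernoulliAvg_split x]
      simp only [e1, e2]
      obtain ⟨A₁, hA₁, i1⟩ := ih (S := insert x S) (T := T.erase x)
      obtain ⟨A₂, hA₂, i2⟩ := ih (S := S) (T := T.erase x)
      have hq : 0 ≤ 1 - q := by linarith
      have hxA : x ∉ A₂ := fun h => notMem_erase x T (hA₂ h)
      have hs := hf.insert_add_le (subset_union_left : D ∪ S ⊆ D ∪ S ∪ A₂) (u := x)
        (by simp [hxA])
      rw [union_insert] at i1
      have a1 := mul_le_mul_of_nonneg_left i1 h0
      have a2 := mul_le_mul_of_nonneg_left i2 hq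
      have a3 := mul_le_mul_of_nonneg_left hs (mul_nonneg h0 hq)
      have key : ∀ a, q * a ≤ q * (q * f (insert x (D ∪ S) ∪ A₁)) +
            q * ((1 - q) * f (insert x (D ∪ S ∪ A₂))) →
          (1 - q) * f (D ∪ S) + q * a ≤ q * bernoulliAvg q (fun L =>
              f (D ∪ (insert x S ∪ visited f I r L n (insert x S) (T.erase x) ∩ L))) +
            (1 - q) * bernoulliAvg q (fun L =>
              f (D ∪ (S ∪ visited f I r L n S (T.erase x) ∩ L))) := by
        intro a ha
        linarith
      have e3 : ∀ A, insert x (D ∪ S) ∪ A = D ∪ S ∪ insert x A := by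
        intro A; rw [insert_union, union_insert]
      have hins : ∀ A ⊆ T.erase x, insert x A ⊆ T := fun A hA =>
        insert_subset hx (hA.trans (erase_subset _ _))
      rw [e3, ← union_insert] at key
      -- The two outcomes of the coin of `x` supply different witnesses `A₁` and `A₂`; the one of
      -- smaller value is below their weighted average and serves both.
      rcases le_total (f (D ∪ S ∪ insert x A₁)) (f (D ∪ S ∪ insert x A₂)) with hle | hle
      · refine ⟨insert x A₁, hins _ hA₁, key _ ?_⟩
        have := mul_le_mul_of_nonneg_left hle (mul_nonneg h0 hq)
        linarith
      · refine ⟨insert x A₂, hins _ hA₂, key _ ?_⟩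
        have := mul_le_mul_of_nonneg_left hle (mul_nonneg h0 h0)
        linarith

theorem bernoulliAvg₂_split (x : E) (Φ : Finset E → Finset E → ℝ) : bernoulliAvg₂ q p Φ =
    q * p * bernoulliAvg₂ q p (fun L C => Φ (insert x L) (insert x C)) +
    q * (1 - p) * bernoulliAvg₂ q p (fun L C => Φ (insert x L) (C.erase x)) +
    (1 - q) * p * bernoulliAvg₂ q p (fun L C => Φ (L.erase x) (insert x C)) +
    (1 - q) * (1 - p) * bernoulliAvg₂ q p (fun L C => Φ (L.erase x) (C.erase x)) := by
  unfold bernoulliAvg₂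
  rw [bernoulliAvg_split x]
  simp only [fun L => bernoulliAvg_split (q := p) x (fun C => Φ L C), bernoulliAvg_add,
    bernoulliAvg_const_mul]
  ring

/-- Whether an element belongs to `L` or to `C` is independent of the event that it is visited, and
of the sets of elements visited before. -/
theorem bernoulliAvg₂_trace (ψ : Bool → Bool → ℝ) (h : E × Finset E × Finset E → ℝ) :
    bernoulliAvg₂ q p (fun L C => ((trace f I r L C n S N T).map fun t =>
        ψ (decide (t.1 ∈ L)) (decide (t.1 ∈ C)) * h t).sum) =
      (q * p * ψ true true + q * (1 - p) * ψ true false + (1 - q) * p * ψ false true +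
          (1 - q) * (1 - p) * ψ false false) *
        bernoulliAvg₂ q p (fun L C => ((trace f I r L C n S N T).map h).sum) := by
  induction n generalizing S N T with
  | zero => simp [trace, bernoulliAvg₂_const]
  | succ n ih =>
    cases hb : best f I r S T with
    | none => simp [trace_none hb, bernoulliAvg₂_const]
    | some x =>
      have mem_ins : ∀ {T : Finset E} (K : Finset E), ∀ y ∈ T.erase x, y ∈ insert x K ↔ y ∈ K :=
        fun K y hy => by simp [ne_of_mem_erase hy]
      have mem_er : ∀ {T : Finset E} (K : Finset E), ∀ y ∈ T.erase x, y ∈ K.erase x ↔ y ∈ K :=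
        fun K y hy => by simp [ne_of_mem_erase hy]
      have congr_sum : ∀ {L L' C C' : Finset E} (S N : Finset E),
          (∀ y ∈ T.erase x, y ∈ L ↔ y ∈ L') → (∀ y ∈ T.erase x, y ∈ C ↔ y ∈ C') →
          ((trace f I r L C n S N (T.erase x)).map fun t =>
            ψ (decide (t.1 ∈ L)) (decide (t.1 ∈ C)) * h t).sum =
          ((trace f I r L' C' n S N (T.erase x)).map fun t =>
            ψ (decide (t.1 ∈ L')) (decide (t.1 ∈ C')) * h t).sum := by
        intro L L' C C' S N hL hC
        rw [trace_congr hL hC]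
        congr 1
        refine List.map_congr_left fun t ht => ?_
        have htT : t.1 ∈ T.erase x :=
          visited_subset (mem_map_fst_trace.1 (List.mem_map_of_mem (f := Prod.fst) ht))
        simp only [hL _ htT, hC _ htT]
      -- The head `(x, S, N)` is fixed before the coins of `x` are tossed, so it contributes the
      -- mean of `ψ`; in each of the four branches the tail is the same process without these coins,
      -- and `ih` applies.
      rw [bernoulliAvg₂_split x,
        bernoulliAvg₂_split x (fun L C => ((trace f I r L C (n + 1) S N T).map h).sum)]
      simp only [trace_some hb, List.map_cons, List.sum_cons, bernoulliAvg₂_add,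
        bernoulliAvg₂_const, mem_insert_self, notMem_erase, if_true, if_false, not_true, not_false_iff,
        and_true, and_false, decide_true, decide_false,
        congr_sum _ _ (mem_ins _) (mem_ins _), congr_sum _ _ (mem_ins _) (mem_er _),
        congr_sum _ _ (mem_er _) (mem_ins _), congr_sum _ _ (mem_er _) (mem_er _)]
      simp only [trace_congr (mem_ins _) (mem_ins _), trace_congr (mem_ins _) (mem_er _),
        trace_congr (mem_er _) (mem_ins _), trace_congr (mem_er _) (mem_er _), ih]
      ring

end average

/-! ### Exchange arguments in the matroid. -/

section matroid

variable {E : Type*} {M : Matroid E}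

/-- By Hall's theorem `J` injects into `B` without decreasing weight. For `s ⊆ J` whose lightest
element is `u`, the whole independent set `s` is spanned by the elements of `B` of weight at least
`v u`, so there are at least `#s` of these. -/
theorem sum_le_sum_of_mem_closure {J B : Finset E} (hJ : M.Indep (J : Set E)) {v w : E → ℝ}
    (hw : ∀ b ∈ B, 0 ≤ w b) (h : ∀ u ∈ J, u ∈ M.closure {b | b ∈ B ∧ v u ≤ w b}) :
    ∑ u ∈ J, v u ≤ ∑ b ∈ B, w b := by
  classical
  obtain ⟨φ, hinj, hφ⟩ := (Finset.all_card_le_biUnion_card_iff_exists_injective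
    (fun u : J => B.filter fun b => v u ≤ w b)).1 (by
      intro s
      rcases s.eq_empty_or_nonempty with rfl | hs
      · simp
      obtain ⟨u, hu, hmin⟩ := s.exists_min_image (fun u => v u) hs
      refine le_trans ?_ (card_le_card (subset_biUnion_of_mem _ hu))
      have hsub : ((s.map (Function.Embedding.subtype _) : Finset E) : Set E) ⊆
          M.closure ((B.filter fun b => v u ≤ w b : Finset E) : Set E) := by
        intro y hy
        simp only [coe_map, Set.mem_image, mem_coe] at hy
        obtain ⟨y, hy, rfl⟩ := hy
        refine M.closure_subset_closure ?_ (h y y.2)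
        intro b hb
        simp only [coe_filter, Set.mem_ofPred_eq] at hb ⊢
        exact ⟨hb.1, (hmin y hy).trans hb.2⟩
      have hind : M.Indep ((s.map (Function.Embedding.subtype _) : Finset E) : Set E) := by
        refine hJ.subset fun y hy => ?_
        simp only [coe_map, Set.mem_image, mem_coe] at hy
        obtain ⟨y, hy, rfl⟩ := hy
        exact y.2
      have := hind.encard_le_eRk_of_subset hsub
      rw [M.eRk_closure_eq] at this
      have := this.trans (M.eRk_le_encard _)
      rw [Set.encard_coe_eq_coe_finsetCard, Set.encard_coe_eq_coe_finsetCard, card_map] at this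
      exact_mod_cast this)
  calc ∑ u ∈ J, v u = ∑ u : J, v u := (sum_coe_sort J v).symm
    _ ≤ ∑ u : J, w (φ u) := sum_le_sum fun u _ => (mem_filter.1 (hφ u)).2
    _ = ∑ b ∈ univ.map ⟨φ, hinj⟩, w b := by rw [sum_map]; rfl
    _ ≤ ∑ b ∈ B, w b := by
      refine sum_le_sum_of_subset_of_nonneg ?_ fun b hb _ => hw b hb
      intro b hb
      obtain ⟨u, -, rfl⟩ := mem_map.1 hb
      exact (mem_filter.1 (hφ u)).1

theorem indep_anti (M : Matroid E) (A B : Finset E) (hAB : A ⊆ B) (hB : M.Indep (B : Set E)) :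
    M.Indep (A : Set E) :=
  hB.subset (coe_subset.2 hAB)

variable [DecidableEq E] {f : Finset E → ℝ} {r : E ↪ ℕ} {L C S T N D : Finset E} {x u : E} {n : ℕ}

/-- An element of positive marginal value that is never visited is spanned by elements that were
kept before and have a larger marginal value. -/
theorem mem_closure_of_notMem_visited (hE : M.E = Set.univ) (hf : IsNonnegSubmodular f)
    (hS : Disjoint S T) (hSI : M.Indep (S : Set E)) (hn : #T ≤ n) (huT : u ∈ T)
    (hu : u ∉ visited f (fun A => M.Indep (A : Set E)) r L n S T)
    {g : ℝ} (hg : g = gain f (S ∪ visited f (fun A => M.Indep (A : Set E)) r L n S T ∩ L) u)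
    (hpos : 0 < g) :
    u ∈ M.closure (S ∪ {b | b ∈ visited f (fun A => M.Indep (A : Set E)) r L n S T ∩ L ∧
      g ≤ visitGain f (fun A => M.Indep (A : Set E)) r L n S T b}) := by
  by_cases hcl : u ∈ M.closure (S : Set E)
  · exact M.closure_subset_closure Set.subset_union_left hcl
  induction n generalizing S T with
  | zero =>
    have := card_pos.2 ⟨u, huT⟩
    omega
  | succ n ih =>
    have huS : u ∉ S := disjoint_right.1 hS huT
    -- While `u` is not spanned by `S` it remains eligible, its marginal value being at least `g >
    -- 0`. So the process cannot stop, and every element it visits has marginal value at least `g`.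
    have hel : 0 < gain f S u → Eligible f (fun A => M.Indep (A : Set E)) S u := by
      refine fun h => ⟨?_, h⟩
      change M.Indep ((insert u S : Finset E) : Set E)
      rw [coe_insert, hSI.insert_indep_iff]
      left
      rw [hE]
      exact ⟨trivial, hcl⟩
    have hle : g ≤ gain f S u := by
      rw [hg]
      refine hf.gain_le_gain subset_union_left ?_
      simp [huS, hu]
    cases hb : best f (fun A => M.Indep (A : Set E)) r S T with
    | none => exact absurd (hel (hpos.trans_le hle)) (best_eq_none_iff.1 hb u huT)
    | some x =>
      have hx := best_eq_some_iff.1 hb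
      rw [visited_some hb] at hu hg ⊢
      have hux : u ≠ x := fun h => hu (by simp [h])
      have hcard : #(T.erase x) ≤ n := by rw [card_erase_of_mem hx.1]; omega
      by_cases hxL : x ∈ L
      · rw [if_pos hxL] at hu hg ⊢
        have hgx : g ≤ gain f S x := hle.trans (hx.gain_le huT (hel (hpos.trans_le hle)))
        have hmono : (↑(insert x S) ∪ {b | b ∈ visited f (fun A => M.Indep (A : Set E)) r L n
              (insert x S) (T.erase x) ∩ L ∧
              g ≤ visitGain f (fun A => M.Indep (A : Set E)) r L n (insert x S) (T.erase x) b}) ⊆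
            (S : Set E) ∪ {b | b ∈ insert x (visited f (fun A => M.Indep (A : Set E)) r L n
              (insert x S) (T.erase x)) ∩ L ∧
              g ≤ visitGain f (fun A => M.Indep (A : Set E)) r L (n + 1) S T b} := by
          have hxx : x ∈ (S : Set E) ∪ {b | b ∈ insert x (visited f (fun A => M.Indep (A : Set E))
              r L n (insert x S) (T.erase x)) ∩ L ∧
              g ≤ visitGain f (fun A => M.Indep (A : Set E)) r L (n + 1) S T b} := by
            right
            rw [Set.mem_ofPred_eq, visitGain_some hb, if_pos rfl]
            exact ⟨by simp [hxL], hgx⟩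
          rintro b (hb' | ⟨hb', hb''⟩)
          · rw [coe_insert] at hb'
            rcases hb' with rfl | hb'
            · exact hxx
            · exact Or.inl hb'
          · right
            have hbx : b ≠ x := ne_of_mem_erase (visited_subset (mem_inter.1 hb').1)
            rw [Set.mem_ofPred_eq, visitGain_some hb, if_neg hbx, if_pos hxL]
            exact ⟨by simp [mem_inter.1 hb'], hb''⟩
        refine M.closure_subset_closure hmono ?_
        by_cases hcl' : u ∈ M.closure ((insert x S : Finset E) : Set E)
        · exact M.closure_subset_closure Set.subset_union_left hcl'
        refine ih ?_ hx.2.1.1 hcard (mem_erase.2 ⟨hux, huT⟩)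
          (fun h => hu (mem_insert_of_mem h)) ?_ hcl'
        · have := disjoint_ite_insert_erase hS (p := True) (x := x)
          simpa using this
        · rw [hg, insert_inter_of_mem hxL, union_insert, insert_union]
      · rw [if_neg hxL] at hu hg ⊢
        rw [insert_inter_of_notMem hxL] at hg ⊢
        have := ih (hS.mono_right (erase_subset _ _)) hSI hcard (mem_erase.2 ⟨hux, huT⟩)
          (fun h => hu (mem_insert_of_mem h)) hg hcl
        refine M.closure_subset_closure (Set.union_subset_union_right _ ?_) this
        rintro b ⟨hb', hb''⟩
        have hbx : b ≠ x := ne_of_mem_erase (visited_subset (mem_inter.1 hb').1)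
        rw [Set.mem_ofPred_eq, visitGain_some hb, if_neg hbx, if_neg hxL]
        exact ⟨hb', hb''⟩

end matroid

/-! ### Inequalities for fixed `L` and `C`. -/

section pointwise

variable {E : Type*} {M : Matroid E} [DecidableEq E] {f : Finset E → ℝ} {r : E ↪ ℕ}
  {L C S T N : Finset E} {n : ℕ}

theorem indep_kept (hSI : M.Indep (S : Set E)) : M.Indep
    (↑(S ∪ visited f (fun A => M.Indep (A : Set E)) r L n S T ∩ L) : Set E) := by
  induction n generalizing S T with
  | zero => simpa [visited] using hSI
  | succ n ih =>
    cases hb : best f (fun A => M.Indep (A : Set E)) r S T with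
    | none => simpa [visited_none hb] using hSI
    | some x =>
      rw [visited_some hb]
      by_cases hx : x ∈ L
      · rw [if_pos hx, insert_inter_of_mem hx, union_insert, ← insert_union]
        exact ih (best_eq_some_iff.1 hb).2.1.1
      · rw [if_neg hx, insert_inter_of_notMem hx]
        exact ih hSI

/-- The visited elements of `C \ L` that are not spanned by earlier ones are independent. -/
theorem indep_unspanned (hE : M.E = Set.univ) {K : Finset E} (hK : M.Indep (K : Set E))
    (hKN : K ⊆ N) : M.Indep (↑(K ∪ traceFilter
      (trace f (fun A => M.Indep (A : Set E)) r L C n S N T)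
      (fun t => t.1 ∈ C \ L ∧ t.1 ∉ M.closure (t.2.2 : Set E))) : Set E) := by
  induction n generalizing S T N K with
  | zero => simpa [trace, traceFilter] using hK
  | succ n ih =>
    cases hb : best f (fun A => M.Indep (A : Set E)) r S T with
    | none => simpa [trace_none hb, traceFilter] using hK
    | some x =>
      rw [trace_some hb]
      by_cases hx : x ∈ C \ L ∧ x ∉ M.closure (N : Set E)
      · have hx' : x ∉ L ∧ x ∈ C := (mem_sdiff.1 hx.1).symm
        have e : traceFilter ((x, S, N) :: trace f (fun A => M.Indep (A : Set E)) r L C n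
              (if x ∈ L then insert x S else S) (if x ∉ L ∧ x ∈ C then insert x N else N)
              (T.erase x)) (fun t => t.1 ∈ C \ L ∧ t.1 ∉ M.closure (t.2.2 : Set E)) =
            insert x (traceFilter (trace f (fun A => M.Indep (A : Set E)) r L C n
              (if x ∈ L then insert x S else S) (if x ∉ L ∧ x ∈ C then insert x N else N)
              (T.erase x)) (fun t => t.1 ∈ C \ L ∧ t.1 ∉ M.closure (t.2.2 : Set E))) := by
          classical
          rw [traceFilter, List.filter_cons_of_pos (by simpa using hx)]
          simp [traceFilter]
        rw [e, union_insert, ← insert_union, if_pos hx']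
        refine ih ?_ (insert_subset_insert x hKN)
        rw [coe_insert, hK.insert_indep_iff]
        left
        rw [hE]
        exact ⟨trivial, fun h => hx.2 (M.closure_subset_closure (coe_subset.2 hKN) h)⟩
      · have e : traceFilter ((x, S, N) :: trace f (fun A => M.Indep (A : Set E)) r L C n
              (if x ∈ L then insert x S else S) (if x ∉ L ∧ x ∈ C then insert x N else N)
              (T.erase x)) (fun t => t.1 ∈ C \ L ∧ t.1 ∉ M.closure (t.2.2 : Set E)) =
            traceFilter (trace f (fun A => M.Indep (A : Set E)) r L C n
              (if x ∈ L then insert x S else S) (if x ∉ L ∧ x ∈ C then insert x N else N)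
              (T.erase x)) (fun t => t.1 ∈ C \ L ∧ t.1 ∉ M.closure (t.2.2 : Set E)) := by
          classical
          rw [traceFilter, List.filter_cons_of_neg (by simpa using hx)]
          simp [traceFilter]
        rw [e]
        exact ih hK (hKN.trans subset_ite_insert)

variable [Fintype E]

open Classical in
/-- The kept elements spanned by earlier elements of `C \ L` weigh at most as much as the latter. -/
theorem sum_spanned_le (hf : IsNonnegSubmodular f) :
    ((trace f (fun A => M.Indep (A : Set E)) r L C n ∅ ∅ univ).map fun t =>
        if t.1 ∈ L ∧ t.1 ∈ M.closure (t.2.2 : Set E) then gain f t.2.1 t.1 else 0).sum ≤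
      ((trace f (fun A => M.Indep (A : Set E)) r L C n ∅ ∅ univ).map fun t =>
        if t.1 ∈ C \ L then gain f t.2.1 t.1 else 0).sum := by
  have h1 := sum_traceFilter (f := f) (I := fun A => M.Indep (A : Set E)) (r := r) (L := L)
    (C := C) (n := n) (S := ∅) (N := ∅) (T := univ)
    (fun t => t.1 ∈ L ∧ t.1 ∈ M.closure (t.2.2 : Set E))
  have h2 := sum_visited_inter (f := f) (I := fun A => M.Indep (A : Set E)) (r := r) (L := L)
    (C := C) (n := n) (S := ∅) (N := ∅) (T := univ) (C \ L)
  rw [← h2, ← h1]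
  have hk := indep_kept (M := M) (f := f) (r := r) (L := L) (n := n) (S := ∅) (T := univ)
    (by simp)
  refine sum_le_sum_of_mem_closure (M := M) ?_ (fun b _ => visitGain_nonneg) ?_
  · refine hk.subset (coe_subset.2 fun u hu => ?_)
    obtain ⟨t, ht, hP, rfl⟩ := mem_traceFilter.1 hu
    rw [empty_union, mem_inter]
    exact ⟨mem_map_fst_trace.1 (List.mem_map_of_mem (f := Prod.fst) ht), hP.1⟩
  · intro u hu
    obtain ⟨t, ht, hP, rfl⟩ := mem_traceFilter.1 hu
    refine M.closure_subset_closure ?_ hP.2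
    intro b hb
    rcases gain_le_visitGain_of_mem hf (indep_anti M) (disjoint_empty_left _)
      (disjoint_empty_left _) ht hb with h | ⟨h, h'⟩
    · simp at h
    · refine ⟨h, ?_⟩
      rw [visitGain_eq_gain ht]
      exact h'

/-- Bounds the marginals of `D` over the final kept set. Visited elements of `D` outside `L` are
worth at most their marginal value at the visit. Unvisited ones of positive marginal value are
spanned by kept elements that weigh at least as much, so exchange bounds their total by the weight
of `V ∩ L`. -/
theorem union_kept_le (hE : M.E = Set.univ) (hf : IsNonnegSubmodular f)
    {D : Finset E} (hD : M.Indep (D : Set E)) {V : Finset E}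
    (hV : V = visited f (fun A => M.Indep (A : Set E)) r L (Fintype.card E) ∅ univ) {w : E → ℝ}
    (hw : w = visitGain f (fun A => M.Indep (A : Set E)) r L (Fintype.card E) ∅ univ) :
    f (D ∪ V ∩ L) ≤ f (V ∩ L) + ∑ u ∈ V ∩ Lᶜ, w u + ∑ u ∈ V ∩ L, w u := by
  classical
  have hw0 : ∀ u, 0 ≤ w u := fun u => hw ▸ visitGain_nonneg
  have h1 := hf.union_le_add_sum_gain (V ∩ L) D
  rw [union_comm] at h1
  have h2 := sum_filter_add_sum_filter_not (D \ (V ∩ L)) (· ∈ V) (fun u => gain f (V ∩ L) u)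
  have h3 : ∑ u ∈ (D \ (V ∩ L)).filter (· ∈ V), gain f (V ∩ L) u ≤ ∑ u ∈ V ∩ Lᶜ, w u := by
    calc _ ≤ ∑ u ∈ (D \ (V ∩ L)).filter (· ∈ V), w u := by
          refine sum_le_sum fun u hu => ?_
          obtain ⟨hu1, hu2⟩ := mem_filter.1 hu
          rw [mem_sdiff] at hu1
          have hu3 := hu2
          rw [hV, ← mem_map_fst_trace (C := ∅) (N := ∅), List.mem_map] at hu3
          obtain ⟨t, ht, rfl⟩ := hu3
          rw [hw, visitGain_eq_gain ht]
          refine hf.gain_le_gain ?_ hu1.2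
          have := subset_kept ht
          rwa [empty_union, ← hV] at this
      _ ≤ _ := by
          refine sum_le_sum_of_subset_of_nonneg ?_ fun u _ _ => hw0 u
          intro u hu
          simp only [mem_filter, mem_sdiff, mem_inter, mem_compl] at hu ⊢
          tauto
  have h4 : ∑ u ∈ (D \ (V ∩ L)).filter (· ∉ V), gain f (V ∩ L) u ≤ ∑ u ∈ V ∩ L, w u := by
    calc _ ≤ ∑ u ∈ ((D \ (V ∩ L)).filter (· ∉ V)).filter (fun u => 0 < gain f (V ∩ L) u),
          gain f (V ∩ L) u := by
          rw [← sum_filter_add_sum_filter_not _ (fun u => 0 < gain f (V ∩ L) u)]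
          have : ∑ u ∈ ((D \ (V ∩ L)).filter (· ∉ V)).filter (fun u => ¬ 0 < gain f (V ∩ L) u),
              gain f (V ∩ L) u ≤ 0 :=
            sum_nonpos fun u hu => not_lt.1 (mem_filter.1 hu).2
          linarith
      _ ≤ _ := by
          refine sum_le_sum_of_mem_closure (M := M) ?_ (fun b _ => hw0 b) ?_
          · refine hD.subset (coe_subset.2 fun u hu => ?_)
            simp only [mem_filter, mem_sdiff] at hu
            exact hu.1.1.1
          · intro u hu
            simp only [mem_filter] at hu
            have := mem_closure_of_notMem_visited (M := M) (r := r) (L := L) (S := ∅) (T := univ)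
              (n := Fintype.card E) (u := u) hE hf (disjoint_empty_left _) (by simp) le_rfl
              (mem_univ u) (by rw [← hV]; exact hu.1.2) rfl
              (by rw [← hV, empty_union]; exact hu.2)
            rw [← hV, ← hw, empty_union, coe_empty, Set.empty_union] at this
            exact this
  linarith

/-- The weight of `u` in the simulated linear instance. -/
noncomputable def onlineWeight {ι : Type*} [DecidableEq ι] (f : Finset ι → ℝ)
    (I : Finset ι → Prop) (r : ι ↪ ℕ) (L C : Finset ι) (u : ι) : ℝ :=
  if u ∈ C \ L then visitGain f I r L #(insert u L) ∅ (insert u L) u else 0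

/-- Elements outside `L` are discarded anyway, so all of them except `u` may be removed in advance.
This links what is computable at the arrival of `u` with the single global process used in the
analysis. -/
theorem onlineWeight_eq (I : Finset E → Prop) (u : E) : onlineWeight f I r L C u =
    if u ∈ C \ L then visitGain f I r L (Fintype.card E) ∅ univ u else 0 := by
  unfold onlineWeight
  refine if_congr Iff.rfl ?_ rfl
  exact (visitGain_eq_of_subset (subset_univ _) (fun y _ hy => mem_insert_of_mem hy)
    (mem_insert_self _ _) le_rfl le_rfl).symm

theorem onlineWeight_nonneg {ι : Type*} [DecidableEq ι] (f : Finset ι → ℝ)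
    (I : Finset ι → Prop) (r : ι ↪ ℕ) (L C : Finset ι) (u : ι) :
    0 ≤ onlineWeight f I r L C u := by
  unfold onlineWeight
  split_ifs
  · exact visitGain_nonneg
  · exact le_rfl

theorem onlineWeight_pos_iff (I : Finset E → Prop) (u : E) : 0 < onlineWeight f I r L C u ↔
    u ∈ visited f I r L (Fintype.card E) ∅ univ ∩ (C \ L) := by
  rw [onlineWeight_eq, mem_inter, mem_visited_iff]
  split_ifs with h <;> simp [h]

theorem sum_onlineWeight (I : Finset E → Prop) (R : Finset E) :
    ∑ u ∈ R, onlineWeight f I r L C u =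
      ∑ u ∈ visited f I r L (Fintype.card E) ∅ univ ∩ (R ∩ (C \ L)),
        visitGain f I r L (Fintype.card E) ∅ univ u := by
  simp only [onlineWeight_eq, ← sum_filter, filter_mem_eq_inter]
  refine (sum_subset inter_subset_right fun u hu hu' => ?_).symm
  exact visitGain_of_notMem fun h => hu' (mem_inter.2 ⟨h, hu⟩)

/-- The set `R` may depend arbitrarily on `L` and `C`, so independence is unavailable for it. The
error term therefore runs over all visited elements of `C \ L`, whose mean can be computed. -/
theorem add_sum_onlineWeight_le (hf : IsNonnegSubmodular f) (I : Finset E → Prop)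
    (R : Finset E) :
    f ∅ + ∑ u ∈ R, onlineWeight f I r L C u -
      (((trace f I r L C (Fintype.card E) ∅ ∅ univ).map fun t =>
        if t.1 ∈ C \ L then gain f t.2.1 t.1 else 0).sum -
      ((trace f I r L C (Fintype.card E) ∅ ∅ univ).map fun t =>
        if t.1 ∈ C \ L then gain f (t.2.1 ∪ t.2.2) t.1 else 0).sum) ≤
    f (R ∩ (visited f I r L (Fintype.card E) ∅ univ ∩ (C \ L))) := by
  rw [sum_onlineWeight, sum_visited_inter (C := C) (N := ∅)]
  have h1 := sum_gain_le (I := I) (r := r) (L := L) (C := C) (n := Fintype.card E) hf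
    (disjoint_empty_left univ) (disjoint_empty_left univ) R
  rw [empty_union, inter_empty] at h1
  -- Passing from `S` to `S ∪ N` never raises a marginal, so the drop over `R ∩ (C \ L)` is at most
  -- the drop over `C \ L`.
  have h2 : ((trace f I r L C (Fintype.card E) ∅ ∅ univ).map fun t =>
        (if t.1 ∈ R ∩ (C \ L) then gain f t.2.1 t.1 else 0) +
        (if t.1 ∈ C \ L then gain f (t.2.1 ∪ t.2.2) t.1 else 0)).sum ≤
      ((trace f I r L C (Fintype.card E) ∅ ∅ univ).map fun t =>
        (if t.1 ∈ R ∩ (C \ L) then gain f (t.2.1 ∪ t.2.2) t.1 else 0) +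
        (if t.1 ∈ C \ L then gain f t.2.1 t.1 else 0)).sum := by
    refine List.sum_le_sum fun t ht => ?_
    obtain ⟨-, h2, h3, -, -, -⟩ :=
      mem_of_mem_trace (disjoint_empty_left univ) (disjoint_empty_left univ) ht
    have := hf.gain_le_gain (subset_union_left : t.2.1 ⊆ t.2.1 ∪ t.2.2) (u := t.1)
      (by simp [h2, h3])
    by_cases hC : t.1 ∈ C \ L
    · by_cases hR : t.1 ∈ R
      · simp only [hR, hC, mem_inter, and_self, if_true]; linarith
      · simp only [hR, hC, mem_inter, if_true, if_false, false_and]; linarith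
    · simp [hC]
  rw [List.sum_map_add, List.sum_map_add] at h2
  linarith

end pointwise

/-! ### Expected values and the constant. -/

section expectation

variable {E : Type*} [Fintype E] [DecidableEq E] {f : Finset E → ℝ} {I : Finset E → Prop}
  {r : E ↪ ℕ} {S T N : Finset E} {n : ℕ} {p q : ℝ}

theorem bernoulliAvg₂_trace_mem (h : E × Finset E × Finset E → ℝ) :
    bernoulliAvg₂ q p (fun L C => ((trace f I r L C n S N T).map fun t =>
        if t.1 ∈ L then h t else 0).sum) =
      q * bernoulliAvg₂ q p (fun L C => ((trace f I r L C n S N T).map h).sum) := by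
  have := bernoulliAvg₂_trace (f := f) (I := I) (r := r) (S := S) (T := T) (N := N) (n := n)
    (p := p) (q := q) (fun b _ => if b then 1 else 0) h
  simp only [decide_eq_true_eq, ite_mul, one_mul, zero_mul] at this
  rw [this]
  simp
  left
  ring

theorem bernoulliAvg₂_trace_notMem (h : E × Finset E × Finset E → ℝ) :
    bernoulliAvg₂ q p (fun L C => ((trace f I r L C n S N T).map fun t =>
        if t.1 ∈ Lᶜ then h t else 0).sum) =
      (1 - q) * bernoulliAvg₂ q p (fun L C => ((trace f I r L C n S N T).map h).sum) := by
  have := bernoulliAvg₂_trace (f := f) (I := I) (r := r) (S := S) (T := T) (N := N) (n := n)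
    (p := p) (q := q) (fun b _ => if ¬ b then 1 else 0) h
  simp only [decide_eq_true_eq, ite_mul, one_mul, zero_mul, ← mem_compl] at this
  rw [this]
  simp
  left
  ring

theorem bernoulliAvg₂_trace_sdiff (h : E × Finset E × Finset E → ℝ) :
    bernoulliAvg₂ q p (fun L C => ((trace f I r L C n S N T).map fun t =>
        if t.1 ∈ C \ L then h t else 0).sum) =
      (1 - q) * p * bernoulliAvg₂ q p (fun L C => ((trace f I r L C n S N T).map h).sum) := by
  have := bernoulliAvg₂_trace (f := f) (I := I) (r := r) (S := S) (T := T) (N := N) (n := n)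
    (p := p) (q := q) (fun b c => if c ∧ ¬ b then 1 else 0) h
  simp only [decide_eq_true_eq, ite_mul, one_mul, zero_mul, ← mem_sdiff] at this
  rw [this]
  simp

theorem bernoulliAvg₂_trace_union (h : E × Finset E × Finset E → ℝ) :
    bernoulliAvg₂ q p (fun L C => ((trace f I r L C n S N T).map fun t =>
        if t.1 ∈ L ∨ t.1 ∈ C then h t else 0).sum) =
      (q + (1 - q) * p) *
        bernoulliAvg₂ q p (fun L C => ((trace f I r L C n S N T).map h).sum) := by
  have := bernoulliAvg₂_trace (f := f) (I := I) (r := r) (S := S) (T := T) (N := N) (n := n)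
    (p := p) (q := q) (fun b c => if b ∨ c then 1 else 0) h
  simp only [decide_eq_true_eq, ite_mul, one_mul, zero_mul] at this
  rw [this]
  simp
  left
  ring

/-- The simulated greedy process keeps, on average, a sixth of the optimal value. -/
theorem le_six_mul_avg_kept {M : Matroid E} (hE : M.E = Set.univ) (hf : IsNonnegSubmodular f)
    {D : Finset E} (hD : M.Indep (D : Set E)) :
    f D ≤ 6 * bernoulliAvg (1 / 2) (fun L =>
      f (visited f (fun A => M.Indep (A : Set E)) r L (Fintype.card E) ∅ univ ∩ L)) := by
  set I : Finset E → Prop := fun A => M.Indep (A : Set E) with hI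
  set V : Finset E → Finset E := fun L => visited f I r L (Fintype.card E) ∅ univ with hV
  have h1 : bernoulliAvg₂ (1 / 2) (1 / 2) (fun L _ => f (V L ∩ L)) =
      bernoulliAvg (1 / 2) (fun L => f (V L ∩ L)) := by
    simp only [bernoulliAvg₂, bernoulliAvg_const]
  set Z := bernoulliAvg₂ (1 / 2) (1 / 2) (fun L C =>
    ((trace f I r L C (Fintype.card E) ∅ ∅ univ).map fun t => gain f t.2.1 t.1).sum) with hZ
  have h2 := bernoulliAvg₂_trace_mem (f := f) (I := I) (r := r) (S := ∅) (T := univ) (N := ∅)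
    (n := Fintype.card E) (p := 1 / 2) (q := 1 / 2) (fun t => gain f t.2.1 t.1)
  have h3 := bernoulliAvg₂_trace_notMem (f := f) (I := I) (r := r) (S := ∅) (T := univ) (N := ∅)
    (n := Fintype.card E) (p := 1 / 2) (q := 1 / 2) (fun t => gain f t.2.1 t.1)
  have h4 : bernoulliAvg₂ (1 / 2) (1 / 2) (fun L _ => f (D ∪ V L ∩ L)) ≤
      bernoulliAvg₂ (1 / 2) (1 / 2) (fun L C => f (V L ∩ L) +
        ((trace f I r L C (Fintype.card E) ∅ ∅ univ).map fun t =>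
          if t.1 ∈ Lᶜ then gain f t.2.1 t.1 else 0).sum +
        ((trace f I r L C (Fintype.card E) ∅ ∅ univ).map fun t =>
          if t.1 ∈ L then gain f t.2.1 t.1 else 0).sum) := by
    refine bernoulliAvg₂_mono (by norm_num) (by norm_num) (by norm_num) (by norm_num)
      fun L C => ?_
    rw [← sum_visited_inter, ← sum_visited_inter]
    exact union_kept_le hE hf hD rfl rfl
  rw [bernoulliAvg₂_add, bernoulliAvg₂_add, h1, h2, h3, ← hZ] at h4
  -- Discarding `f (D ∪ A) ≥ 0` leaves `f D / 2`; the upper bound `F + Z = 3F - 2 f ∅` on the same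
  -- average gives the factor 6.
  obtain ⟨A, -, h5⟩ := exists_le_bernoulliAvg_kept (I := I) (r := r) (S := ∅) (T := univ)
    (n := Fintype.card E) hf (q := 1 / 2) (by norm_num) (by norm_num) D
  simp only [empty_union, union_empty] at h5
  have h6 := hf.1 (D ∪ A)
  have h7 : bernoulliAvg₂ (1 / 2) (1 / 2) (fun L _ => f (D ∪ V L ∩ L)) =
      bernoulliAvg (1 / 2) (fun L => f (D ∪ V L ∩ L)) := by
    simp only [bernoulliAvg₂, bernoulliAvg_const]
  simp only [sum_gain_kept, empty_union] at h2
  rw [bernoulliAvg₂_sub, bernoulliAvg₂_const, h1, ← hZ] at h2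
  have h8 := hf.1 ∅
  linarith

/-- A lower bound for the expected value of the simulated algorithm, if in each simulated linear
instance it is at least that of the visited part of a random set `R` whose expected weight is at
least the optimum divided by `α`. -/
theorem le_bernoulliAvg₂ {M : Matroid E} (hE : M.E = Set.univ) (hf : IsNonnegSubmodular f)
    {α : ℝ} (hα : 1 ≤ α) {Ω : Type*} [Fintype Ω] (R : Ω → Finset E)
    (d : Finset E → Finset E → Ω → ℝ) (hd0 : ∀ L C ω, 0 ≤ d L C ω) (hd1 : ∀ L C, ∑ ω, d L C ω = 1)
    (hd : ∀ L C (J : Finset E), M.Indep (J : Set E) →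
      (∑ u ∈ J, onlineWeight f (fun A => M.Indep (A : Set E)) r L C u) / α ≤
        ∑ ω, d L C ω * ∑ u ∈ R ω, onlineWeight f (fun A => M.Indep (A : Set E)) r L C u)
    {D : Finset E} (hD : M.Indep (D : Set E)) :
    f D / (24 * α * (3 * α + 1)) ≤ bernoulliAvg₂ (1 / 2) (1 / (4 * α)) (fun L C =>
      ∑ ω, d L C ω * f (R ω ∩
        (visited f (fun A => M.Indep (A : Set E)) r L (Fintype.card E) ∅ univ ∩ (C \ L)))) := by
  classical
  set I : Finset E → Prop := fun A => M.Indep (A : Set E) with hI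
  set V : Finset E → Finset E := fun L => visited f I r L (Fintype.card E) ∅ univ with hV
  -- To leading order in `p`, interaction inside `C \ L` costs `2p²F`, while the linear guarantee
  -- earns `pF/α`; this choice makes the latter `4p²F`.
  set p : ℝ := 1 / (4 * α) with hp
  have hα0 : 0 < α := by linarith
  have hp0 : 0 < p := by positivity
  have hp4 : p ≤ 1 / 4 := by
    rw [hp]
    exact one_div_le_one_div_of_le (by norm_num) (by linarith)
  have hp1 : p ≤ 1 := by linarith
  have hαp : 1 / α = 4 * p := by rw [hp]; field_simp
  set tr : Finset E → Finset E → List (E × Finset E × Finset E) :=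
    fun L C => trace f I r L C (Fintype.card E) ∅ ∅ univ with htr
  set F := bernoulliAvg (1 / 2) (fun L => f (V L ∩ L)) with hF
  have hFD : f D ≤ 6 * F := le_six_mul_avg_kept hE hf hD
  have mono : ∀ {Φ Ψ : Finset E → Finset E → ℝ}, (∀ L C, Φ L C ≤ Ψ L C) →
      bernoulliAvg₂ (1 / 2) p Φ ≤ bernoulliAvg₂ (1 / 2) p Ψ :=
    fun h => bernoulliAvg₂_mono (by norm_num) (by norm_num) hp0.le hp1 h
  have hF2 : bernoulliAvg₂ (1 / 2) p (fun L _ => f (V L ∩ L)) = F := by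
    simp only [bernoulliAvg₂, bernoulliAvg_const, hF]
  -- Over the visited elements, `Z` averages the marginals over `S`, `U` those over `S ∪ N`, and `Y`
  -- the part of `Z` due to elements spanned by `N`.
  set Z := bernoulliAvg₂ (1 / 2) p (fun L C => ((tr L C).map fun t => gain f t.2.1 t.1).sum) with hZ
  set U := bernoulliAvg₂ (1 / 2) p (fun L C =>
    ((tr L C).map fun t => gain f (t.2.1 ∪ t.2.2) t.1).sum) with hU
  set Y := bernoulliAvg₂ (1 / 2) p (fun L C => ((tr L C).map fun t =>
    if t.1 ∈ M.closure (t.2.2 : Set E) then gain f t.2.1 t.1 else 0).sum) with hY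
  have z1 : F - f ∅ = 1 / 2 * Z := by
    have h := bernoulliAvg₂_trace_mem (f := f) (I := I) (r := r) (S := ∅) (T := univ) (N := ∅)
      (n := Fintype.card E) (p := p) (q := 1 / 2) (fun t => gain f t.2.1 t.1)
    simp only [sum_gain_kept, empty_union] at h
    rwa [bernoulliAvg₂_sub, bernoulliAvg₂_const, hF2] at h
  have z2 := bernoulliAvg₂_trace_sdiff (f := f) (I := I) (r := r) (S := ∅) (T := univ) (N := ∅)
    (n := Fintype.card E) (p := p) (q := 1 / 2) (fun t => gain f t.2.1 t.1)
  have u1 := bernoulliAvg₂_trace_sdiff (f := f) (I := I) (r := r) (S := ∅) (T := univ) (N := ∅)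
    (n := Fintype.card E) (p := p) (q := 1 / 2) (fun t => gain f (t.2.1 ∪ t.2.2) t.1)
  have u2 : (1 - p) * F - f ∅ ≤ (1 + p) * (U / 2) := by
    have h := bernoulliAvg₂_trace_union (f := f) (I := I) (r := r) (S := ∅) (T := univ) (N := ∅)
      (n := Fintype.card E) (p := p) (q := 1 / 2) (fun t => gain f (t.2.1 ∪ t.2.2) t.1)
    simp only [sum_gain_union, empty_union] at h
    rw [bernoulliAvg₂_sub, bernoulliAvg₂_const] at h
    -- Given `L`, the set `V L` is fixed and `C` is still independent, so the nonadaptive sampling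
    -- lemma suffices here.
    have h' : (1 - p) * F ≤ bernoulliAvg₂ (1 / 2) p (fun L C => f (V L ∩ L ∪ V L ∩ (C \ L))) := by
      rw [hF, ← bernoulliAvg_const_mul]
      refine bernoulliAvg_mono (by norm_num) (by norm_num) fun L => ?_
      have h := hf.le_bernoulliAvg hp0.le hp1 (V L ∩ L) (V L \ L)
      have e : ∀ C, V L \ L ∩ C = V L ∩ (C \ L) := by
        intro C; ext y; simp only [mem_inter, mem_sdiff]; tauto
      simp only [e] at h
      have := mul_nonneg hp0.le (hf.1 (V L ∩ L ∪ V L \ L))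
      linarith
    linarith
  -- Being spanned by `N` is decided before the coin for `L`: half of `Y` sits on kept elements, and
  -- exchange bounds that half by the weight of the visited part of `C \ L`.
  have y1 : 1 / 2 * Y ≤ (1 - 1 / 2) * p * Z := by
    have h := bernoulliAvg₂_trace_mem (f := f) (I := I) (r := r) (S := ∅) (T := univ) (N := ∅)
      (n := Fintype.card E) (p := p) (q := 1 / 2)
      (fun t => if t.1 ∈ M.closure (t.2.2 : Set E) then gain f t.2.1 t.1 else 0)
    rw [← h, ← z2]
    refine mono fun L C => ?_
    simp only [← ite_and]
    exact sum_spanned_le hf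
  have y2 := bernoulliAvg₂_trace_sdiff (f := f) (I := I) (r := r) (S := ∅) (T := univ) (N := ∅)
    (n := Fintype.card E) (p := p) (q := 1 / 2)
    (fun t => if t.1 ∈ M.closure (t.2.2 : Set E) then gain f t.2.1 t.1 else 0)
  have main : ∀ L C, f ∅ -
      (((tr L C).map fun t => if t.1 ∈ C \ L then gain f t.2.1 t.1 else 0).sum -
      ((tr L C).map fun t => if t.1 ∈ C \ L then gain f (t.2.1 ∪ t.2.2) t.1 else 0).sum) +
      4 * p * (((tr L C).map fun t => if t.1 ∈ C \ L then gain f t.2.1 t.1 else 0).sum -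
        ((tr L C).map fun t => if t.1 ∈ C \ L then
          (if t.1 ∈ M.closure (t.2.2 : Set E) then gain f t.2.1 t.1 else 0) else 0).sum) ≤
      ∑ ω, d L C ω * f (R ω ∩ (V L ∩ (C \ L))) := by
    intro L C
    have h1 := sum_le_sum fun ω (_ : ω ∈ univ) => mul_le_mul_of_nonneg_left
      (add_sum_onlineWeight_le (r := r) (L := L) (C := C) hf I (R ω)) (hd0 L C ω)
    simp only [add_sub_right_comm, mul_add, sum_add_distrib] at h1
    rw [← sum_mul, hd1, one_mul] at h1
    have h2 := indep_unspanned (r := r) (f := f) (S := ∅) (T := univ) (n := Fintype.card E)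
      (N := ∅) (L := L) (C := C) (K := ∅) hE (by simp) (empty_subset _)
    rw [empty_union] at h2
    have h3 := hd L C _ h2
    have h4 : ∑ u ∈ traceFilter (tr L C)
        (fun t => t.1 ∈ C \ L ∧ t.1 ∉ M.closure (t.2.2 : Set E)), onlineWeight f I r L C u =
        ((tr L C).map fun t => if t.1 ∈ C \ L then gain f t.2.1 t.1 else 0).sum -
        ((tr L C).map fun t => if t.1 ∈ C \ L then
          (if t.1 ∈ M.closure (t.2.2 : Set E) then gain f t.2.1 t.1 else 0) else 0).sum := by
      rw [eq_sub_iff_add_eq]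
      have : ∑ u ∈ traceFilter (tr L C)
          (fun t => t.1 ∈ C \ L ∧ t.1 ∉ M.closure (t.2.2 : Set E)), onlineWeight f I r L C u =
          ∑ u ∈ traceFilter (tr L C) (fun t => t.1 ∈ C \ L ∧ t.1 ∉ M.closure (t.2.2 : Set E)),
            visitGain f I r L (Fintype.card E) ∅ univ u := by
        refine sum_congr rfl fun u hu => ?_
        obtain ⟨t, ht, hP, rfl⟩ := mem_traceFilter.1 hu
        rw [onlineWeight_eq, if_pos hP.1]
      rw [this, sum_traceFilter, ← List.sum_map_add]
      congr 1
      refine List.map_congr_left fun t _ => ?_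
      by_cases h1 : t.1 ∈ C \ L <;> by_cases h2 : t.1 ∈ M.closure (t.2.2 : Set E) <;>
        simp only [h1, h2, and_self, not_true, not_false_iff, and_true, and_false,
          if_true, if_false, add_zero, zero_add]
    rw [div_eq_mul_one_div, hαp] at h3
    rw [h4, mul_comm] at h3
    exact (add_le_add le_rfl h3).trans h1
  have havg := mono main
  rw [bernoulliAvg₂_add, bernoulliAvg₂_sub, bernoulliAvg₂_sub, bernoulliAvg₂_const_mul,
    bernoulliAvg₂_sub, bernoulliAvg₂_const, z2, u1, y2, ← hZ, ← hU, ← hY] at havg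
  refine le_trans ?_ havg
  have hc := hf.1 ∅
  have hF0 : 0 ≤ F := by have := hf.1 D; linarith
  -- Divides `u2` by `1 + p`, using `(1 + p)(1 - p)² ≤ 1 - p` and `f ∅ ≥ 0`.
  have u3 : (1 - p) ^ 2 * F - f ∅ ≤ U / 2 := by
    have : (1 + p) * ((1 - p) ^ 2 * F - f ∅) ≤ (1 + p) * (U / 2) := by
      refine le_trans ?_ u2
      have : 0 ≤ (1 - p) * p ^ 2 * F := by
        have : 0 ≤ 1 - p := by linarith
        positivity
      have := mul_nonneg hp0.le hc
      linarith
    exact le_of_mul_le_mul_left this (by linarith)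
  have hα4 : α = 1 / (4 * p) := by rw [hp]; field_simp
  have hval : p ^ 2 * (2 - 3 * p) * F ≤ f ∅ - ((1 - 1 / 2) * p * Z - (1 - 1 / 2) * p * U) +
      4 * p * ((1 - 1 / 2) * p * Z - (1 - 1 / 2) * p * Y) := by
    have a1 := mul_le_mul_of_nonneg_left u3 hp0.le
    have a2 := mul_le_mul_of_nonneg_left y1 (by positivity : 0 ≤ 4 * p * p)
    have a3 : 0 ≤ f ∅ * (1 - 4 * p ^ 2 * (1 - p)) := by
      refine mul_nonneg hc ?_
      nlinarith
    have hZ' : Z = 2 * (F - f ∅) := by linarith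
    rw [hZ'] at a2 ⊢
    linarith
  refine le_trans ?_ hval
  have e : f D / (24 * α * (3 * α + 1)) = f D * (2 * p ^ 2) / (3 * (3 + 4 * p)) := by
    rw [hα4]
    field_simp
    ring
  rw [e, div_le_iff₀ (by linarith)]
  have b1 : f D * (2 * p ^ 2) ≤ 6 * F * (2 * p ^ 2) :=
    mul_le_mul_of_nonneg_right hFD (by positivity)
  -- For `p ≤ 1/4` one has `(2 - 3p)(3 + 4p) ≥ 4`, which is what the stated constant needs.
  have b2 : 0 ≤ F * p ^ 2 * (3 * ((2 - 3 * p) * (3 + 4 * p) - 4)) := by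
    refine mul_nonneg (by positivity) ?_
    nlinarith
  linarith

end expectation

/-! ### Delaying the sample: virtual arrival times and the simulation. -/

/-- A permutation that moves the elements of `B` to the front and keeps the order of the others. -/
theorem exists_perm_front {n : ℕ} (B : Finset (Fin n)) : ∃ π : Equiv.Perm (Fin n),
    (∀ s, s ∈ B ↔ (π s : ℕ) < #B) ∧ ∀ s s', s ∉ B → s' ≤ s → π s' ≤ π s := by
  have hcard : #B + #Bᶜ = n := by rw [card_add_card_compl, Fintype.card_fin]
  set e := (finSumEquivOfFinset (s := B) rfl rfl).symm.trans
    (finSumFinEquiv.trans (finCongr hcard)) with he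
  have hl : ∀ i, (e (B.orderEmbOfFin rfl i) : ℕ) = i := by
    intro i
    have := (finSumEquivOfFinset (s := B) rfl rfl).symm_apply_apply (Sum.inl i)
    rw [finSumEquivOfFinset_inl] at this
    simp [he, this]
  have hr : ∀ i, (e (Bᶜ.orderEmbOfFin rfl i) : ℕ) = #B + i := by
    intro i
    have := (finSumEquivOfFinset (s := B) rfl rfl).symm_apply_apply (Sum.inr i)
    rw [finSumEquivOfFinset_inr] at this
    simp [he, this]
  have mem_iff : ∀ (A : Finset (Fin n)) (s : Fin n), s ∈ A → ∃ i, A.orderEmbOfFin rfl i = s := by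
    intro A s hs
    rw [← mem_coe, ← A.range_orderEmbOfFin rfl] at hs
    exact hs
  have h1 : ∀ s, s ∈ B ↔ (e s : ℕ) < #B := by
    intro s
    by_cases hs : s ∈ B
    · obtain ⟨i, rfl⟩ := mem_iff B s hs
      rw [hl]
      exact ⟨fun _ => i.2, fun _ => hs⟩
    · obtain ⟨i, rfl⟩ := mem_iff Bᶜ s (mem_compl.2 hs)
      rw [hr]
      exact ⟨fun h => absurd h hs, fun h => by omega⟩
  refine ⟨e, h1, fun s s' hs hss => ?_⟩
  by_cases hs' : s' ∈ B
  · have a1 := (h1 s').1 hs'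
    have a2 := mt (h1 s).2 hs
    rw [Fin.le_def]
    omega
  · obtain ⟨i, rfl⟩ := mem_iff Bᶜ s (mem_compl.2 hs)
    obtain ⟨j, rfl⟩ := mem_iff Bᶜ s' (mem_compl.2 hs')
    rw [OrderEmbedding.le_iff_le, Fin.le_def] at hss
    rw [Fin.le_def, hr, hr]
    omega

/-- A permutation that moves the elements of `B` to the front and keeps the order of the others. -/
noncomputable def permFront {n : ℕ} (B : Finset (Fin n)) : Equiv.Perm (Fin n) :=
  (exists_perm_front B).choose

theorem mem_iff_permFront_lt {n : ℕ} (B : Finset (Fin n)) (s : Fin n) :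
    s ∈ B ↔ (permFront B s : ℕ) < #B :=
  (exists_perm_front B).choose_spec.1 s

theorem permFront_le {n : ℕ} {B : Finset (Fin n)} {s s' : Fin n} (hs : s ∉ B) (h : s' ≤ s) :
    permFront B s' ≤ permFront B s :=
  (exists_perm_front B).choose_spec.2 s s' hs h

/-- The virtual arrival times of the first `t + 1` arriving elements, if the elements of the sample,
which arrive first, are delayed to the virtual arrival times in `B`. -/
noncomputable def virtualTime {n t : ℕ} (B : Finset (Fin n)) (ht : t < n) : Fin (t + 1) ↪ Fin n :=
  (Fin.castLEEmb ht).trans (permFront B).symm.toEmbedding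

/-- The real arrival times of the elements that have virtually arrived at time `s`. -/
noncomputable def realTime {n t : ℕ} (B : Finset (Fin n)) (ht : t < n) {s : Fin n}
    (hs : s = (permFront B).symm ⟨t, ht⟩) (hsB : s ∉ B) : Fin ((s : ℕ) + 1) ↪ Fin (t + 1) where
  toFun i := ⟨permFront B (Fin.castLE s.2 i), by
    -- Whatever virtually precedes a non-sample element has really arrived: sample elements come
    -- first in real time, and the others keep their order.
    have h : permFront B (Fin.castLE s.2 i) ≤ permFront B s :=
      permFront_le hsB (Nat.lt_succ_iff.1 i.2)
    have h' : permFront B s = ⟨t, ht⟩ := by rw [hs, Equiv.apply_symm_apply]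
    exact Nat.lt_succ_iff.2 (h.trans h'.le)⟩
  inj' i j h := by
    have := Fin.mk.inj_iff.1 h
    have := (permFront B).injective (Fin.ext this)
    exact Fin.castLE_injective _ this

/-- The random choices of the simulation: the virtual arrival times of the sample, the virtual
arrival times of the elements that are not ignored, and a permutation for breaking ties. -/
abbrev SimulationSeed (n : ℕ) : Type :=
  Finset (Fin n) × Finset (Fin n) × Equiv.Perm (Fin n)

/-- The weights of the simulated linear instance. -/
noncomputable def simulatedWeight {Λ : Type l} {n t : ℕ} (θ : SimulationSeed n) (ht : t < n)
    (V : OracleData Λ (Fin (t + 1))) : Fin (t + 1) → ℝ :=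
  onlineWeight V.value V.indep
    ((virtualTime θ.1 ht).trans (θ.2.2.toEmbedding.trans Fin.valEmbedding))
    (univ.filter fun j => virtualTime θ.1 ht j ∈ θ.1)
    (univ.filter fun j => virtualTime θ.1 ht j ∈ θ.2.1)

/-- The oracles that are passed to the algorithm for linear objectives. -/
noncomputable def simulatedOracle {Λ : Type l} {n t : ℕ} (θ : SimulationSeed n) (ht : t < n)
    (V : OracleData Λ (Fin (t + 1))) {κ : Type*} (e : κ ↪ Fin (t + 1)) : OracleData Λ κ where
  label i := V.label (e i)
  value S := ∑ i ∈ S, simulatedWeight θ ht V (e i)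
  indep S := V.indep (S.map e)

open Classical in
/-- The decision of the simulation about the element arriving at time `t`, where `accept` are the
decisions of the algorithm for linear objectives. -/
noncomputable def simulatedAccept {Λ : Type l} {n : ℕ}
    (accept : ∀ t : ℕ, OracleData Λ (Fin (t + 1)) → Bool) (θ : SimulationSeed n) (t : ℕ)
    (V : OracleData Λ (Fin (t + 1))) : Bool :=
  if ht : t < n then
    -- A sample element has weight zero in the linear instance, so rejecting it agrees with the
    -- positivity test applied to the others.
    if hs : (permFront θ.1).symm ⟨t, ht⟩ ∈ θ.1 then false
    else accept _ (simulatedOracle θ ht V (realTime θ.1 ht rfl hs)) &&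
      decide (0 < simulatedWeight θ ht V (Fin.last t))
  else false

/-- The probability of a seed of the simulation. -/
noncomputable def simulationProb (p : ℝ) {n : ℕ} (θ : SimulationSeed n) : ℝ :=
  (1 / 2) ^ #θ.1 * (1 - 1 / 2) ^ (n - #θ.1) * (p ^ #θ.2.1 * (1 - p) ^ (n - #θ.2.1)) /
    (n.factorial : ℝ)

theorem simulationProb_nonneg {p : ℝ} (h0 : 0 ≤ p) (h1 : p ≤ 1) {n : ℕ} (θ : SimulationSeed n) :
    0 ≤ simulationProb p θ := by
  have : 0 ≤ 1 - p := by linarith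
  unfold simulationProb
  have h2 : (0 : ℝ) ≤ 1 - 1 / 2 := by norm_num
  positivity

theorem sum_simulationProb_mul (p : ℝ) {n : ℕ} (g : SimulationSeed n → ℝ) :
    ∑ θ, simulationProb p θ * g θ = bernoulliAvg₂ (1 / 2) p (fun B C =>
      (∑ τ : Equiv.Perm (Fin n), g (B, C, τ)) / (n.factorial : ℝ)) := by
  simp only [Fintype.sum_prod_type, bernoulliAvg₂, bernoulliAvg, simulationProb, Fintype.card_fin,
    mul_sum, sum_div]
  refine sum_congr rfl fun B _ => sum_congr rfl fun C _ => sum_congr rfl fun τ _ => ?_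
  ring

theorem sum_simulationProb (p : ℝ) (n : ℕ) : ∑ θ : SimulationSeed n, simulationProb p θ = 1 := by
  have := sum_simulationProb_mul p (n := n) fun _ => 1
  simp only [mul_one] at this
  rw [this]
  have hn : (n.factorial : ℝ) ≠ 0 := by exact_mod_cast n.factorial_ne_zero
  simp [Fintype.card_perm, div_self hn, bernoulliAvg₂_const]

/-! ### A run of the simulation is a run of the linear algorithm in virtual order. -/

section run

theorem onlineWeight_map {E κ : Type*} [DecidableEq E] [DecidableEq κ] (e : κ ↪ E) {f : Finset E → ℝ}
    {I : Finset E → Prop} {r : E ↪ ℕ} {K C : Finset κ} {C' : Finset E} {v : κ}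
    (h : v ∈ C ↔ e v ∈ C') :
    onlineWeight (fun B => f (B.map e)) (fun B => I (B.map e)) (e.trans r) K C v =
      onlineWeight f I r (K.map e) C' (e v) := by
  unfold onlineWeight
  have := visitGain_map (f := f) (I := I) (r := r) (n := #(insert v K)) e K ∅ (insert v K) v
  rw [map_empty, map_insert] at this
  rw [← map_insert, card_map, ← this]
  simp [h, mem_sdiff, map_insert]

variable {Λ : Type l} {E : Type u} [Fintype E]

theorem arrived_apply (σ : ArrivalOrder E) (t : Fin (Fintype.card E)) (j : Fin ((t : ℕ) + 1)) :
    σ.arrived t j = σ (Fin.castLE t.2 j) := rfl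

theorem OnlineAlgorithm.mem_run {A : OnlineAlgorithm.{l, v} Λ} {O : OracleData Λ E}
    {σ : ArrivalOrder E} {ω : A.Seed (Fintype.card E)} {x : E} :
    x ∈ A.run O σ ω ↔ A.accept (Fintype.card E) ω (σ.symm x)
      (O.restrict (σ.arrived (σ.symm x))) = true := by
  simp only [OnlineAlgorithm.run, mem_map, mem_filter, mem_univ, true_and]
  constructor
  · rintro ⟨t, ht, h⟩
    obtain rfl : t = σ.symm x := by rw [← h]; simp
    exact ht
  · intro h
    exact ⟨σ.symm x, h, by simp⟩

/-- The order in which the elements of `E` virtually arrive. -/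
noncomputable def virtualOrder (σ : ArrivalOrder E) (B : Finset (Fin (Fintype.card E))) :
    ArrivalOrder E :=
  (permFront B).trans σ

/-- The priorities by which ties are broken. -/
def tieBreak (ρ : E ≃ Fin (Fintype.card E)) : E ↪ ℕ :=
  ρ.toEmbedding.trans Fin.valEmbedding

theorem arrived_eq_virtualTime (σ : ArrivalOrder E) (B : Finset (Fin (Fintype.card E)))
    (t : Fin (Fintype.card E)) :
    σ.arrived t = (virtualTime B t.2).trans (virtualOrder σ B).toEmbedding := by
  ext j
  simp [arrived_apply, virtualTime, virtualOrder]

theorem realTime_trans_arrived (σ : ArrivalOrder E) (B : Finset (Fin (Fintype.card E)))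
    (t : Fin (Fintype.card E)) {s : Fin (Fintype.card E)} (hs : s = (permFront B).symm t)
    (hsB : s ∉ B) :
    (realTime B t.2 hs hsB).trans (σ.arrived t) = (virtualOrder σ B).arrived s := by
  ext j
  rfl

variable [DecidableEq E]

/-- Once a non-sample element arrives the whole sample has arrived, so the visible sample is all of
`L`. The visible part of `C` may be incomplete, but only the membership of the element being weighed
matters. -/
theorem simulatedWeight_eq (M : Matroid E) (lab : E → Λ) (f : Finset E → ℝ)
    (θ : SimulationSeed (Fintype.card E)) (σ : ArrivalOrder E) (t : Fin (Fintype.card E))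
    (hs : (permFront θ.1).symm t ∉ θ.1) (j : Fin ((t : ℕ) + 1)) :
    simulatedWeight θ t.2 ((smspInstance M lab f).restrict (σ.arrived t)) j =
      onlineWeight f (fun A => M.Indep (A : Set E))
        (tieBreak ((virtualOrder σ θ.1).symm.trans θ.2.2))
        (θ.1.map (virtualOrder σ θ.1).toEmbedding) (θ.2.1.map (virtualOrder σ θ.1).toEmbedding)
        (σ.arrived t j) := by
  set σ' := virtualOrder σ θ.1 with hσ'
  have hmap : (univ.filter fun j => virtualTime θ.1 t.2 j ∈ θ.1).map (σ.arrived t) =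
      θ.1.map σ'.toEmbedding := by
    rw [arrived_eq_virtualTime σ θ.1 t, ← hσ', ← map_map]
    congr 1
    ext s
    simp only [mem_map, mem_filter, mem_univ, true_and]
    constructor
    · rintro ⟨j, hj, rfl⟩
      exact hj
    · intro hs'
      have h1 := (mem_iff_permFront_lt θ.1 s).1 hs'
      have h2 := mt (mem_iff_permFront_lt θ.1 _).2 hs
      rw [Equiv.apply_symm_apply] at h2
      refine ⟨⟨permFront θ.1 s, by omega⟩, ?_, ?_⟩ <;> simp [virtualTime, hs']
  have hr : (virtualTime θ.1 t.2).trans (θ.2.2.toEmbedding.trans Fin.valEmbedding) =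
      (σ.arrived t).trans (tieBreak (σ'.symm.trans θ.2.2)) := by
    rw [arrived_eq_virtualTime σ θ.1 t]
    ext j
    simp [tieBreak, ← hσ']
  rw [← hmap, simulatedWeight, hr]
  refine onlineWeight_map (f := f) (I := fun A => M.Indep (A : Set E)) (σ.arrived t) (C' := θ.2.1.map σ'.toEmbedding) ?_
  rw [arrived_eq_virtualTime σ θ.1 t, ← hσ']
  simp

theorem simulatedAccept_iff (M : Matroid E) (lab : E → Λ) (f : Finset E → ℝ)
    (θ : SimulationSeed (Fintype.card E)) (σ : ArrivalOrder E) (x : E)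
    (accept : ∀ t : ℕ, OracleData Λ (Fin (t + 1)) → Bool) {w : E → ℝ}
    (hw : w = onlineWeight f (fun A => M.Indep (A : Set E))
        (tieBreak ((virtualOrder σ θ.1).symm.trans θ.2.2))
        (θ.1.map (virtualOrder σ θ.1).toEmbedding) (θ.2.1.map (virtualOrder σ θ.1).toEmbedding)) :
    simulatedAccept accept θ (σ.symm x)
        ((smspInstance M lab f).restrict (σ.arrived (σ.symm x))) = true ↔
      accept ((virtualOrder σ θ.1).symm x)
        ((mspInstance M lab w).restrict
          ((virtualOrder σ θ.1).arrived ((virtualOrder σ θ.1).symm x))) = true ∧ 0 < w x := by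
  have hs : (virtualOrder σ θ.1).symm x = (permFront θ.1).symm (σ.symm x) := rfl
  unfold simulatedAccept
  rw [dif_pos (σ.symm x).2]
  simp only [Fin.eta]
  split_ifs with h
  · simp only [false_iff, not_and, not_lt]
    intro _
    rw [hw]
    unfold onlineWeight
    rw [if_neg]
    intro hx
    refine (mem_sdiff.1 hx).2 ?_
    rw [← hs] at h
    exact mem_map.2 ⟨_, h, by simp⟩
  · have hweight := simulatedWeight_eq M lab f θ σ (σ.symm x) h
    rw [← hw] at hweight
    have hlast : σ.arrived (σ.symm x) (Fin.last _) = x := by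
      rw [arrived_apply]
      have : Fin.castLE (σ.symm x).2 (Fin.last (σ.symm x : ℕ)) = σ.symm x := by ext; simp
      rw [this, Equiv.apply_symm_apply]
    have hO : simulatedOracle θ (σ.symm x).2
        ((smspInstance M lab f).restrict (σ.arrived (σ.symm x)))
        (realTime θ.1 (σ.symm x).2 rfl h) =
        (mspInstance M lab w).restrict
          ((virtualOrder σ θ.1).arrived ((permFront θ.1).symm (σ.symm x))) := by
      have htr := realTime_trans_arrived σ θ.1 (σ.symm x) rfl h
      rw [← htr]
      unfold simulatedOracle OracleData.restrict mspInstance smspInstance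
      congr 1
      · funext S
        refine Eq.trans ?_ (sum_map S _ w).symm
        exact sum_congr rfl fun i _ => hweight _
      · funext S
        exact congrArg (fun X : Finset E => M.Indep (X : Set E)) (map_map _ _ S)
    rw [Bool.and_eq_true, decide_eq_true_iff, hweight, hlast, hO]
    rfl

end run

/-! ### The simulation as a randomized online algorithm. -/

/-- The seeds of the simulation, in an arbitrary universe. -/
structure LiftedSeed (n : ℕ) : Type v where
  /-- the seed -/
  down : SimulationSeed n

instance (n : ℕ) : Countable (LiftedSeed.{v} n) :=
  Function.Injective.countable (f := LiftedSeed.down) fun ⟨_⟩ ⟨_⟩ h => congrArg _ h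

instance (n : ℕ) : MeasurableSpace (LiftedSeed.{v} n) := ⊤

instance (n : ℕ) : DiscreteMeasurableSpace (LiftedSeed.{v} n) := ⟨fun _ => trivial⟩

namespace OnlineAlgorithm

variable {Λ : Type l} (A : OnlineAlgorithm.{l, v} Λ)

theorem measurable_simulatedAccept (n t : ℕ) (θ : SimulationSeed n)
    (V : OracleData Λ (Fin (t + 1))) : @Measurable _ _ (A.seedSpace n) _
      fun ω => simulatedAccept (A.accept n ω) θ t V := by
  let _ := A.seedSpace n
  by_cases ht : t < n
  · by_cases hs : (permFront θ.1).symm ⟨t, ht⟩ ∈ θ.1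
    · simp only [simulatedAccept, dif_pos ht, dif_pos hs]
      exact measurable_const
    · simp only [simulatedAccept, dif_pos ht, dif_neg hs]
      exact (measurable_from_top (f := fun b : Bool => b && _)).comp (A.measurable_accept _ _ _)
  · simp only [simulatedAccept, dif_neg ht]
    exact measurable_const

/-- The algorithm for submodular objectives that runs `A` on a random order of the elements, with
the weights given by the greedy process on a random sample. -/
noncomputable def simulate (p : ℝ) (h0 : 0 ≤ p) (h1 : p ≤ 1) : OnlineAlgorithm.{l, v} Λ where
  Seed n := A.Seed n × LiftedSeed.{v} n
  seedSpace n := @Prod.instMeasurableSpace _ _ (A.seedSpace n) _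
  law n :=
    letI := A.seedSpace n
    ∑ θ : SimulationSeed n, ENNReal.ofReal (simulationProb p θ) •
      (A.law n).map fun ω => (ω, LiftedSeed.mk.{v} θ)
  isProbabilityMeasure_law n := by
    let _ := A.seedSpace n
    have _ := A.isProbabilityMeasure_law n
    constructor
    rw [MeasureTheory.Measure.finsetSum_apply]
    have : ∀ θ : SimulationSeed n, (A.law n).map
        (fun ω => (ω, LiftedSeed.mk.{v} θ)) Set.univ = 1 := by
      intro θ
      rw [MeasureTheory.Measure.map_apply measurable_prodMk_right MeasurableSet.univ]
      simp
    simp only [MeasureTheory.Measure.smul_apply, this, smul_eq_mul, mul_one]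
    rw [← ENNReal.ofReal_sum_of_nonneg fun θ _ => simulationProb_nonneg h0 h1 θ,
      sum_simulationProb, ENNReal.ofReal_one]
  accept n ω t V := simulatedAccept (A.accept n ω.1) ω.2.down t V
  measurable_accept n t V := by
    let _ := A.seedSpace n
    exact measurable_from_prod_countable_left fun θ => A.measurable_simulatedAccept n t θ.down V

variable {E : Type u} [Fintype E]

theorem measurableSet_run (O : OracleData Λ E) (σ : ArrivalOrder E) (S : Finset E) :
    @MeasurableSet _ (A.seedSpace _) {ω | A.run O σ ω = S} := by
  let _ := A.seedSpace (Fintype.card E)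
  have : {ω | A.run O σ ω = S} = ⋂ x : E, {ω | x ∈ A.run O σ ω ↔ x ∈ S} := by
    ext ω
    simp [Finset.ext_iff]
  rw [this]
  refine MeasurableSet.iInter fun x => ?_
  simp only [mem_run]
  have h := A.measurable_accept (Fintype.card E) (σ.symm x)
    (O.restrict (σ.arrived (σ.symm x))) (measurableSet_singleton true)
  by_cases hx : x ∈ S
  · simp only [hx, iff_true]
    exact h
  · simp only [hx, iff_false]
    exact h.compl

open Classical in
theorem run_simulate [DecidableEq E] {p : ℝ} (h0 : 0 ≤ p) (h1 : p ≤ 1) (M : Matroid E) (lab : E → Λ)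
    (f : Finset E → ℝ) (σ : ArrivalOrder E) (ω : A.Seed (Fintype.card E))
    (θ : SimulationSeed (Fintype.card E)) {w : E → ℝ}
    (hw : w = onlineWeight f (fun A => M.Indep (A : Set E))
        (tieBreak ((virtualOrder σ θ.1).symm.trans θ.2.2))
        (θ.1.map (virtualOrder σ θ.1).toEmbedding) (θ.2.1.map (virtualOrder σ θ.1).toEmbedding)) :
    (A.simulate p h0 h1).run (smspInstance M lab f) σ (ω, LiftedSeed.mk θ) =
      (A.run (mspInstance M lab w) (virtualOrder σ θ.1) ω).filter (0 < w ·) := by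
  ext x
  rw [mem_filter, mem_run]
  exact (mem_run (A := A.simulate p h0 h1)).trans (simulatedAccept_iff M lab f θ σ x _ hw)

theorem law_simulate {p : ℝ} (h0 : 0 ≤ p) (h1 : p ≤ 1) (O : OracleData Λ E) (σ : ArrivalOrder E)
    (S : Finset E) :
    ((A.simulate p h0 h1).law (Fintype.card E) {ω | (A.simulate p h0 h1).run O σ ω = S}).toReal =
      ∑ θ, simulationProb p θ * (A.law (Fintype.card E)
        {ω | (A.simulate p h0 h1).run O σ (ω, LiftedSeed.mk θ) = S}).toReal := by
  let _ := A.seedSpace (Fintype.card E)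
  have _ := A.isProbabilityMeasure_law (Fintype.card E)
  have hm := (A.simulate p h0 h1).measurableSet_run O σ S
  have : (A.simulate p h0 h1).law (Fintype.card E) {ω | (A.simulate p h0 h1).run O σ ω = S} =
      ∑ θ, ENNReal.ofReal (simulationProb p θ) * A.law (Fintype.card E)
        {ω | (A.simulate p h0 h1).run O σ (ω, LiftedSeed.mk θ) = S} := by
    have key : ∀ T : Set (A.Seed (Fintype.card E) × LiftedSeed.{v} (Fintype.card E)),
        MeasurableSet T → (∑ θ : SimulationSeed (Fintype.card E),
          ENNReal.ofReal (simulationProb p θ) •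
            (A.law _).map fun ω => (ω, LiftedSeed.mk.{v} θ)) T =
        ∑ θ, ENNReal.ofReal (simulationProb p θ) *
          A.law (Fintype.card E) {ω | (ω, LiftedSeed.mk.{v} θ) ∈ T} := by
      intro T hT
      rw [MeasureTheory.Measure.finsetSum_apply]
      refine sum_congr rfl fun θ _ => ?_
      rw [MeasureTheory.Measure.smul_apply, smul_eq_mul,
        MeasureTheory.Measure.map_apply measurable_prodMk_right hT]
      rfl
    exact key _ hm
  rw [this, ENNReal.toReal_sum fun θ _ => ENNReal.mul_ne_top ENNReal.ofReal_ne_top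
    (MeasureTheory.measure_ne_top _ _)]
  refine sum_congr rfl fun θ _ => ?_
  rw [ENNReal.toReal_mul, ENNReal.toReal_ofReal (simulationProb_nonneg h0 h1 θ)]

/-- The expected value of a function of the output. -/
theorem sum_law_run_comp (O : OracleData Λ E) (σ : ArrivalOrder E) (h : Finset E → Finset E)
    (F : Finset E → ℝ) :
    ∑ S, (A.law (Fintype.card E) {ω | h (A.run O σ ω) = S}).toReal * F S =
      ∑ S, (A.law (Fintype.card E) {ω | A.run O σ ω = S}).toReal * F (h S) := by
  classical
  let _ := A.seedSpace (Fintype.card E)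
  have _ := A.isProbabilityMeasure_law (Fintype.card E)
  have key : ∀ S, (A.law (Fintype.card E) {ω | h (A.run O σ ω) = S}).toReal =
      ∑ S' ∈ univ.filter (h · = S), (A.law (Fintype.card E) {ω | A.run O σ ω = S'}).toReal := by
    intro S
    have := MeasureTheory.sum_measureReal_preimage_singleton (μ := A.law (Fintype.card E))
      (univ.filter (h · = S)) (f := fun ω => A.run O σ ω)
      (fun y _ => A.measurableSet_run O σ y)
    refine Eq.trans ?_ this.symm
    rw [MeasureTheory.measureReal_def]
    congr 2
    ext ω
    simp
  simp only [key, sum_mul]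
  rw [← sum_fiberwise univ h (fun S => (A.law (Fintype.card E) {ω | A.run O σ ω = S}).toReal *
    F (h S))]
  refine sum_congr rfl fun S _ => sum_congr rfl fun S' hS' => ?_
  rw [(mem_filter.1 hS').2]

end OnlineAlgorithm

/-! ### Expected value of the simulation. -/

namespace OnlineAlgorithm

variable {Λ : Type l} (A : OnlineAlgorithm.{l, v} Λ) {E : Type u} [Fintype E]

open Classical in
theorem card_arrivalOrder : Fintype.card (ArrivalOrder E) = (Fintype.card E).factorial := by
  rw [Fintype.card_equiv (Fintype.equivFin E).symm, Fintype.card_fin]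

open Classical in
theorem expectedValue_eq (O : OracleData Λ E) : A.expectedValue O =
    (∑ σ : ArrivalOrder E, ∑ S, (A.law (Fintype.card E) {ω | A.run O σ ω = S}).toReal *
      O.value S) / ((Fintype.card E).factorial : ℝ) := by
  unfold expectedValue outputProb
  rw [card_arrivalOrder, sum_comm, sum_div]
  refine sum_congr rfl fun S _ => ?_
  rw [div_mul_eq_mul_div, sum_mul]

-- Decouples the randomness: the virtual order, `L`, `C` and the ranking `ρ` are independent. For
-- fixed `L`, `C` and `ρ` the linear algorithm faces one fixed instance in uniformly random order,
-- so its hypothesis applies.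
open Classical in
theorem expectedValue_simulate {p : ℝ} (h0 : 0 ≤ p) (h1 : p ≤ 1) (M : Matroid E) (lab : E → Λ)
    (f : Finset E → ℝ) :
    (A.simulate p h0 h1).expectedValue (smspInstance M lab f) =
      (∑ ρ : E ≃ Fin (Fintype.card E), bernoulliAvg₂ (1 / 2) p fun L C =>
        ∑ S, A.outputProb (mspInstance M lab
            (onlineWeight f (fun A => M.Indep (A : Set E)) (tieBreak ρ) L C)) S *
          f (S.filter (0 < onlineWeight f (fun A => M.Indep (A : Set E)) (tieBreak ρ) L C ·))) /
      ((Fintype.card E).factorial : ℝ) := by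
  set w : (E ≃ Fin (Fintype.card E)) → Finset E → Finset E → E → ℝ :=
    fun ρ L C => onlineWeight f (fun A => M.Indep (A : Set E)) (tieBreak ρ) L C with hw
  set K : ArrivalOrder E → Finset E → Finset E → (E ≃ Fin (Fintype.card E)) → ℝ :=
    fun σ L C ρ => ∑ S, (A.law (Fintype.card E)
      {ω | A.run (mspInstance M lab (w ρ L C)) σ ω = S}).toReal *
        f (S.filter (0 < w ρ L C ·)) with hK
  have h : ∀ σ : ArrivalOrder E, ∑ S, ((A.simulate p h0 h1).law (Fintype.card E)
        {ω | (A.simulate p h0 h1).run (smspInstance M lab f) σ ω = S}).toReal *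
          (smspInstance M lab f).value S =
      ∑ θ : SimulationSeed (Fintype.card E), simulationProb p θ *
        K (virtualOrder σ θ.1) (θ.1.map (virtualOrder σ θ.1).toEmbedding)
          (θ.2.1.map (virtualOrder σ θ.1).toEmbedding)
          ((virtualOrder σ θ.1).symm.trans θ.2.2) := by
    intro σ
    simp only [law_simulate, sum_mul]
    rw [sum_comm]
    refine sum_congr rfl fun θ _ => ?_
    simp only [mul_assoc]
    rw [← mul_sum]
    congr 1
    simp only [A.run_simulate h0 h1 M lab f σ _ θ rfl]
    exact A.sum_law_run_comp _ _ _ f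
  rw [expectedValue_eq]
  congr 1
  simp only [h]
  rw [sum_comm]
  -- For fixed sample positions, passing to the virtual order is a bijection of arrival orders, so
  -- the virtual order is uniform.
  have h2 : ∀ θ : SimulationSeed (Fintype.card E), ∑ σ : ArrivalOrder E, simulationProb p θ *
        K (virtualOrder σ θ.1) (θ.1.map (virtualOrder σ θ.1).toEmbedding)
          (θ.2.1.map (virtualOrder σ θ.1).toEmbedding)
          ((virtualOrder σ θ.1).symm.trans θ.2.2) =
      ∑ σ : ArrivalOrder E, simulationProb p θ *
        K σ (θ.1.map σ.toEmbedding) (θ.2.1.map σ.toEmbedding) (σ.symm.trans θ.2.2) := by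
    intro θ
    exact Fintype.sum_equiv ⟨fun σ => virtualOrder σ θ.1, fun σ => (permFront θ.1).symm.trans σ,
      fun σ => by ext; simp [virtualOrder], fun σ => by ext; simp [virtualOrder]⟩ _ _ fun _ => rfl
  simp only [h2]
  rw [sum_comm]
  have h3 : ∀ σ : ArrivalOrder E, ∑ θ : SimulationSeed (Fintype.card E), simulationProb p θ *
        K σ (θ.1.map σ.toEmbedding) (θ.2.1.map σ.toEmbedding) (σ.symm.trans θ.2.2) =
      bernoulliAvg₂ (1 / 2) p fun L C => (∑ ρ, K σ L C ρ) / ((Fintype.card E).factorial : ℝ) := by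
    intro σ
    rw [sum_simulationProb_mul]
    -- A uniform permutation composed with the order is again uniform, which makes the ranking
    -- independent of the order.
    have e : ∀ L C, ∑ τ : Equiv.Perm (Fin (Fintype.card E)), K σ L C (σ.symm.trans τ) =
        ∑ ρ, K σ L C ρ := fun L C =>
      Fintype.sum_equiv ⟨fun τ => σ.symm.trans τ, fun ρ => σ.trans ρ,
        fun τ => by ext; simp, fun ρ => by ext; simp⟩ _ _ fun _ => rfl
    simp only [e, bernoulliAvg₂]
    rw [← bernoulliAvg_map σ]
    refine congrArg _ (funext fun B => ?_)
    rw [← bernoulliAvg_map σ]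
  simp only [h3]
  have h4 : ∀ L C, ∑ σ : ArrivalOrder E, (∑ ρ, K σ L C ρ) / ((Fintype.card E).factorial : ℝ) =
      ∑ ρ, ∑ S, A.outputProb (mspInstance M lab (w ρ L C)) S * f (S.filter (0 < w ρ L C ·)) := by
    intro L C
    rw [← sum_div, sum_comm, sum_div]
    refine sum_congr rfl fun ρ _ => ?_
    simp only [hK, outputProb, card_arrivalOrder]
    rw [sum_comm, sum_div]
    refine sum_congr rfl fun S _ => ?_
    rw [div_mul_eq_mul_div, sum_mul]
  have h5 : ∀ {X : Type u} [Fintype X] (Φ : X → Finset E → Finset E → ℝ),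
      ∑ x, bernoulliAvg₂ (1 / 2) p (Φ x) = bernoulliAvg₂ (1 / 2) p fun L C => ∑ x, Φ x L C := by
    intro X _ Φ
    simp only [bernoulliAvg₂, bernoulliAvg, mul_sum]
    rw [sum_comm]
    refine sum_congr rfl fun L _ => ?_
    rw [sum_comm]
  rw [h5, h5]
  simp only [h4]
  rfl

open Classical in
/-- If the output of `A` is a uniformly random one of the sets `P i`, then its expected value is, for
a subadditive objective, at least that of the union of these sets, divided by `k`. -/
theorem le_sum_outputProb_mul {O : OracleData Λ E} {k : ℕ} (D : PMF (Fin k → Finset E))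
    (hD : ∀ S : Finset E, A.outputProb O S =
      (∑ i : Fin k, ∑ P : Fin k → Finset E, if P i = S then (D P).toReal else 0) / k)
    (g : Finset E → ℝ) (hg : ∀ P : Fin k → Finset E, g (univ.biUnion P) ≤ ∑ i, g (P i)) :
    (∑ P, (D P).toReal * g (univ.biUnion P)) / k ≤ ∑ S, A.outputProb O S * g S := by
  have h : ∑ S, A.outputProb O S * g S = (∑ P, (D P).toReal * ∑ i, g (P i)) / k := by
    simp only [hD, div_mul_eq_mul_div]
    rw [← sum_div]
    congr 1
    simp only [sum_mul, ite_mul, zero_mul, mul_sum]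
    rw [sum_comm]
    rw [sum_comm (s := univ) (t := univ) (f := fun P i => (D P).toReal * g (P i))]
    refine sum_congr rfl fun i _ => ?_
    rw [sum_comm]
    refine sum_congr rfl fun P _ => ?_
    simp
  rw [h]
  refine div_le_div_of_nonneg_right (sum_le_sum fun P _ => ?_) (Nat.cast_nonneg k)
  exact mul_le_mul_of_nonneg_left (hg P) ENNReal.toReal_nonneg

end OnlineAlgorithm

/-! ### Competitive ratios and the theorem. -/

theorem sum_biUnion_le_sum {ι E : Type*} [DecidableEq E] {c : E → ℝ} (hc : ∀ e, 0 ≤ c e)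
    (s : Finset ι) (P : ι → Finset E) : ∑ e ∈ s.biUnion P, c e ≤ ∑ i ∈ s, ∑ e ∈ P i, c e := by
  classical
  induction s using Finset.induction_on with
  | empty => simp
  | insert a s ha ih =>
    rw [biUnion_insert, sum_insert ha]
    have h1 := sum_union_inter (s₁ := P a) (s₂ := s.biUnion P) (f := c)
    have h2 : 0 ≤ ∑ e ∈ P a ∩ s.biUnion P, c e := sum_nonneg fun e _ => hc e
    linarith

theorem le_opt {Λ : Type l} {E : Type u} [Finite E] (O : OracleData Λ E) {S : Finset E}
    (hS : O.indep S) : O.value S ≤ O.opt :=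
  le_csSup ((Set.toFinite _).bddAbove) ⟨S, hS, rfl⟩

theorem isMSPCompetitiveOn_of_isUniformChoiceOn {Λ : Type l} (A : OnlineAlgorithm.{l, v} Λ)
    {E : Type u} [Fintype E] {M : Matroid E} {lab : E → Λ} {k : ℕ} {α : ℝ}
    (h : A.IsUniformChoiceOn M lab k α) : A.IsMSPCompetitiveOn M lab (k * α) := by
  classical
  intro c hc
  obtain ⟨D, -, hD2, hD3⟩ := h c hc
  have := A.le_sum_outputProb_mul D hD3 (fun S => ∑ e ∈ S, c e)
    (fun P => sum_biUnion_le_sum hc univ P)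
  refine le_trans ?_ this
  rw [mul_comm, ← div_div]
  exact div_le_div_of_nonneg_right hD2 (Nat.cast_nonneg k)

/-- The bound holds for each tie-breaking order `ρ` separately and is then averaged. The random set
`R` of `le_bernoulliAvg₂` is the union of the `P i`, and subadditivity of `f` on its visited part
accounts for `k`. -/
theorem isSMSPCompetitiveOn_simulate {Λ : Type l} (A : OnlineAlgorithm.{l, v} Λ)
    {E : Type u} [Fintype E] {M : Matroid E} (hE : M.E = Set.univ) {lab : E → Λ} {k : ℕ}
    (hk : 0 < k) {α : ℝ} (hα : 1 ≤ α) (h : A.IsUniformChoiceOn M lab k α)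
    (h0 : 0 ≤ 1 / (4 * α)) (h1 : 1 / (4 * α) ≤ 1) :
    (A.simulate (1 / (4 * α)) h0 h1).IsSMSPCompetitiveOn M lab (24 * k * α * (3 * α + 1)) := by
  classical
  intro f hf
  have hα0 : 0 < α := by linarith
  have hk' : (0 : ℝ) < k := by exact_mod_cast hk
  have hpos : 0 < 24 * k * α * (3 * α + 1) := by positivity
  set I : Finset E → Prop := fun A => M.Indep (A : Set E) with hI
  rw [div_le_iff₀ hpos]
  refine csSup_le ⟨_, ∅, by simp [smspInstance], rfl⟩ ?_
  rintro _ ⟨T, hT, rfl⟩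
  rw [← div_le_iff₀ hpos]
  have key : ∀ ρ : E ≃ Fin (Fintype.card E), f T / (24 * k * α * (3 * α + 1)) ≤
      bernoulliAvg₂ (1 / 2) (1 / (4 * α)) fun L C =>
        ∑ S, A.outputProb (mspInstance M lab (onlineWeight f I (tieBreak ρ) L C)) S *
          f (S.filter (0 < onlineWeight f I (tieBreak ρ) L C ·)) := by
    intro ρ
    choose D hD1 hD2 hD3 using fun L C =>
      h (onlineWeight f I (tieBreak ρ) L C) (onlineWeight_nonneg f I (tieBreak ρ) L C)
    have hmain := le_bernoulliAvg₂ (r := tieBreak ρ) hE hf hα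
      (fun P : Fin k → Finset E => univ.biUnion P) (fun L C P => (D L C P).toReal)
      (fun _ _ _ => ENNReal.toReal_nonneg)
      (fun L C => by
        have := (D L C).tsum_coe
        rw [tsum_fintype] at this
        rw [← ENNReal.toReal_sum fun P _ => (D L C).apply_ne_top P, this, ENNReal.toReal_one])
      (fun L C J hJ => by
        refine le_trans ?_ (hD2 L C)
        refine div_le_div_of_nonneg_right ?_ hα0.le
        exact le_opt (mspInstance M lab _) (S := J) hJ)
      hT
    have e : f T / (24 * k * α * (3 * α + 1)) = 1 / k * (f T / (24 * α * (3 * α + 1))) := by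
      field_simp
    rw [e]
    refine (mul_le_mul_of_nonneg_left hmain (by positivity)).trans ?_
    rw [← bernoulliAvg₂_const_mul]
    refine bernoulliAvg₂_mono (by norm_num) (by norm_num) h0 h1 fun L C => ?_
    have hfilter : ∀ S : Finset E, S.filter (0 < onlineWeight f I (tieBreak ρ) L C ·) =
        S ∩ (visited f I (tieBreak ρ) L (Fintype.card E) ∅ univ ∩ (C \ L)) := by
      intro S
      ext x
      rw [mem_filter, mem_inter, onlineWeight_pos_iff]
    rw [one_div_mul_eq_div]
    simp only [hfilter]
    refine A.le_sum_outputProb_mul (D L C) (hD3 L C)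
      (fun S => f (S ∩ (visited f I (tieBreak ρ) L (Fintype.card E) ∅ univ ∩ (C \ L))))
      fun P => ?_
    rw [biUnion_inter]
    have : (univ : Finset (Fin k)).Nonempty := ⟨⟨0, hk⟩, mem_univ _⟩
    exact hf.biUnion_le_sum this _
  rw [A.expectedValue_simulate, le_div_iff₀ (by exact_mod_cast Nat.factorial_pos _)]
  have := card_nsmul_le_sum univ _ _ fun ρ (_ : ρ ∈ univ) => key ρ
  rw [card_univ, nsmul_eq_mul, Fintype.card_equiv (Fintype.equivFin E), mul_comm] at this
  exact this

/-- Every run outputs a subset of what the linear algorithm accepts on the same matroid with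
non-negative weights. -/
theorem isSMSPAlgorithm_simulate {Λ : Type l} {A : OnlineAlgorithm.{l, v} Λ}
    (hA : OnlineAlgorithm.IsMSPAlgorithm.{l, u, v} A) {p : ℝ} (h0 : 0 ≤ p) (h1 : p ≤ 1) :
    OnlineAlgorithm.IsSMSPAlgorithm.{l, u, v} (A.simulate p h0 h1) := by
  classical
  rintro E _ M hE lab f hf σ ⟨ω, ⟨θ⟩⟩
  rw [A.run_simulate h0 h1 M lab f σ ω θ rfl]
  exact (hA E M hE lab _ (onlineWeight_nonneg _ _ _ _ _) _ ω).subset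
    (coe_subset.2 (filter_subset _ _))

end MatroidSecretary

theorem theorem2 {Λ : Type l} (Linear : OnlineAlgorithm.{l, v} Λ)
    (hLinear : OnlineAlgorithm.IsMSPAlgorithm.{l, u, v} Linear) (α : ℝ) (hα : 1 ≤ α) :
    ∃ A : OnlineAlgorithm.{l, v} Λ, OnlineAlgorithm.IsSMSPAlgorithm.{l, u, v} A ∧
      ∀ (E : Type u) [Fintype E] (M : Matroid E), M.E = Set.univ →
        ∀ (lab : E → Λ) (k : ℕ), 0 < k → Linear.IsUniformChoiceOn M lab k α →
          A.IsSMSPCompetitiveOn M lab (24 * k * α * (3 * α + 1)) ∧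
            Linear.IsMSPCompetitiveOn M lab (k * α) := by
  have h0 : 0 ≤ 1 / (4 * α) := by positivity
  have h1 : 1 / (4 * α) ≤ 1 := by
    rw [div_le_one (by linarith)]
    linarith
  exact ⟨Linear.simulate (1 / (4 * α)) h0 h1, isSMSPAlgorithm_simulate hLinear h0 h1,
    fun E _ M hE lab k hk h => ⟨isSMSPCompetitiveOn_simulate Linear hE hk hα h h0 h1,
      isMSPCompetitiveOn_of_isUniformChoiceOn Linear h⟩⟩
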